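/- For a sequence $K=(k_2,k_3,\dots)$ of complex numbers let the polynomials $\theta_m(z;K)$ be defined by $$\sum_{m\ge 0}\theta_m(z;K)\lambda^m=\exp\Bigl(z\lambda-\sum_{j\ge 2}\frac{k_j\lambda^{2j-1}}{2j-1}\Bigr),$$ let $\Theta_n(z,K)=c_n W(\theta_1,\theta_3,\dots,\theta_{2n-1})$ with $c_n=\prod_{j=1}^n(2j+1)^{n-j}$ and $W$ the Wronskian in $z$ (so $\Theta_0=1$), and let $A_n(z)=\Theta_n(z+\tfrac12,K)$ with $k_j=-\tfrac12$ for all $j\ge 2$; $A_n$ has degree $M=n(n+1)/2$. Define the force map $(\mathbf p,\mathbf q)\mapsto(F_1,\dots,F_M,G_1,\dots,G_M)$ on $\mathbb C^{M}\times\mathbb C^{M}$ by $$F_k=\sum_{j\ne k}\frac1{p_k-p_j}-\sum_{j}\frac1{p_k-q_j},\qquad G_k=\sum_{j\ne k}\frac1{q_k-q_j}-\sum_{j}\frac1{q_k-p_j},$$ and write $DF$ for its complex derivative. Let $n\ge 1$ and assume that $A_n$ and $A_{n-1}$ have no common root, or that $A_n$ has no repeated root. Let $a=(a_1,\dots,a_M)$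 be the roots of $A_n$, listed with multiplicity and numbered so that, for some $i_0$ with $2i_0\le M$, $a_{2i-1}=\bar a_{2i}$ for $i=1,\dots,i_0$ and $\operatorname{Im}a_i=0$ for $i=2i_0+1,\dots,M$. Let $b=(-\bar a_1,\dots,-\bar a_M)$. Then the $a_i$ are pairwise distinct, $a_i\ne b_j$ for all $i,j$, and the force map is complex differentiable at $(a,b)$. Moreover, call $(\xi,\eta)\in\mathbb C^M\times\mathbb C^M$ symmetric if $\eta_i=-\bar\xi_i$ for all $i$, $\xi_{2i-1}=\bar\xi_{2i}$ for $i=1,\dots,i_0$, and $\operatorname{Im}\xi_i=0$ for $i=2i_0+1,\dots,M$. If $(\xi,\eta)$ is symmetric and $DF|_{(a,b)}(\xi,\eta)=0$, then $\xi=\eta=0$. -/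

import Mathlib

open Polynomial

noncomputable section

/-- The exponent `zλ - ∑_{j ≥ 2} k_j λ^(2j-1) / (2j-1)`, as a formal power series in `λ` whose
coefficients are polynomials in `z = X`. Only the values `k 2, k 3, …` are used. -/
def amExponent (k : ℕ → ℂ) : PowerSeries ℂ[X] :=
  PowerSeries.mk fun m =>
    if m = 1 then X
    else if Odd m then -C (k ((m + 1) / 2) / (m : ℂ))
    else 0

/-- `θ_m(z; K)`: the coefficient of `λ^m` in `exp (zλ - ∑_{j ≥ 2} k_j λ^(2j-1) / (2j-1))`. -/
def amTheta (k : ℕ → ℂ) (m : ℕ) : ℂ[X] :=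
  PowerSeries.coeff m ((PowerSeries.exp ℂ[X]).subst (amExponent k))

/-- The Wronskian `W(f_0, …, f_{n-1})` of `n` polynomials. -/
def polyWronskian {n : ℕ} (f : Fin n → ℂ[X]) : ℂ[X] :=
  (Matrix.of fun i j : Fin n => derivative^[(i : ℕ)] (f j)).det

/-- The Adler-Moser polynomial `Θ_n(z, K) = c_n W(θ_1, θ_3, …, θ_{2n-1})`, where
`c_n = ∏_{j=1}^n (2j+1)^(n-j)`. -/
def adlerMoser (n : ℕ) (k : ℕ → ℂ) : ℂ[X] :=
  C (∏ j ∈ Finset.Icc 1 n, (2 * (j : ℂ) + 1) ^ (n - j)) *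
    polyWronskian fun j : Fin n => amTheta k (2 * (j : ℕ) + 1)

/-- `A_n(z) = Θ_n(z - t, K)` with `t = -1/2` and `k_j = -1/2` for all `j ≥ 2`. -/
def symmAdlerMoser (n : ℕ) : ℂ[X] :=
  (adlerMoser n fun _ => -1 / 2).comp (X - C (-1 / 2))

/-- The force map `(p, q) ↦ (F, G)` for `N` positive vortices `p` and `N` negative vortices `q`. -/
def vortexForce (N : ℕ) (x : (Fin N → ℂ) × (Fin N → ℂ)) : (Fin N → ℂ) × (Fin N → ℂ) :=
  (fun k => ∑ j ∈ Finset.univ.erase k, 1 / (x.1 k - x.1 j) - ∑ j, 1 / (x.1 k - x.2 j),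
   fun k => ∑ j ∈ Finset.univ.erase k, 1 / (x.2 k - x.2 j) - ∑ j, 1 / (x.2 k - x.1 j))

/-- `z ↦ z* = -z̄`, the reflection across the imaginary axis, applied to each entry of a vector. -/
def reflectVec {N : ℕ} (v : Fin N → ℂ) : Fin N → ℂ :=
  fun i => -starRingEnd ℂ (v i)

/-- The first `2 i₀` entries of `v` form `i₀` consecutive complex conjugate pairs, and all later
entries are real. (Entries are numbered from `0`, so the pairs are `(v_{2i}, v_{2i+1})`, `i < i₀`.) -/
def IsConjPaired {N : ℕ} (i₀ : ℕ) (v : Fin N → ℂ) : Prop :=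
  (∀ i : ℕ, i < i₀ → ∀ j l : Fin N, (j : ℕ) = 2 * i → (l : ℕ) = 2 * i + 1 →
    v j = starRingEnd ℂ (v l)) ∧
  ∀ j : Fin N, 2 * i₀ ≤ (j : ℕ) → (v j).im = 0

/-- The vector `(ξ, η)` is symmetric: `η = ξ*`, and `ξ` has the conjugation pattern given by `i₀`. -/
def IsSymmetricVec {N : ℕ} (i₀ : ℕ) (ξ η : Fin N → ℂ) : Prop :=
  η = reflectVec ξ ∧ IsConjPaired i₀ ξ

end

open Polynomial

/-! Write τ = W(θ_1, θ_3, …, θ_{2n-1}) for the shifted θ's, a nonzero multiple of A_n, and T_k =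
W(θ_1, …, θ_{2n-1}, θ_k). Since θ_k'' = θ_{k-2}, the span of θ_1, θ_3, …, θ_{2n-1} is stable under
d²/dz². Crum's theorem then intertwines d²/dz² with the Schrödinger operator of potential 2(log
τ)''. With denominators cleared, T[f] = W(θ_1, …, θ_{2n-1}, f) satisfies τT[f]'' - 2τ'T[f]' +
τ''T[f] = τT[f''] (`bordered_hirota`). This identity is used for three choices of f.

For f = e^z, the special k_j and the shift by 1/2 make T[f] a multiple of e^z τ(-z), which gives a
bilinear equation for τ and τ(-z) (`symmTau_bilinear`). At simple roots it says that F = 1 and G =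
-1. For f = 1, T_0 is a multiple of τ_{n-1}, and a root of τ_n that is not a root of τ_{n-1} must be
simple. For f = ∑ θ_k λ^k, which satisfies f'' = λ²f, the T_k/τ are the λ-coefficients of an
eigenfunction ψ.

Let (ξ, η) be symmetric and in the kernel. All moments ∑ ξ_k a_k^r vanish by strong induction on r,
and a Vandermonde argument then gives ξ = 0.

For even r, linearizing the power-sum identities of the equilibrium expresses the signed moment ∑
ξ_k a_k^r - ∑ η_k b_k^r through lower moments (`moment_eq_zero_of_lower`). Symmetry makes η and b
the negatives of ξ and a up to one permutation, so this signed moment is 2 ∑ ξ_k a_k^r.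

For odd r the signed moment is trivially zero, and ψ² is used instead. Eliminating b from the
linearized equations gives ∑_j (ξ_k - ξ_j)/(a_k - a_j)^4 = 0 (`linearized_locus`), so a symmetric
matrix kills ξ. The λ-coefficients of ψ² have the form Q + ∑ A_j/(z - a_j)², and the local
Schrödinger equation puts the vector Q''(a_k) in the range of that same matrix. Hence ∑ ξ_k Q''(a_k)
= 0. A suitable coefficient makes Q'' of exact degree r (`sqCoeff_ne_zero`), which isolates the
moment of order r (`odd_moment_eq_zero`). -/

/-- The monic operator `g ↦ ∇ⁿ g - ∑ i < n, c i * ∇ⁱ g`. -/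
def monicOp {A : Type*} [CommRing A] {n : ℕ} (c : Fin n → A) (nab : A → A) (g : A) : A :=
  nab^[n] g - ∑ i : Fin n, c i * nab^[(i : ℕ)] g

/-- The determinant of the Wronskian matrix of `θ`, bordered by the column `u` and by the row of
`n`-th derivatives. -/
def borderedWronskian {A : Type*} [CommRing A] {n : ℕ} (D : A → A) (θ : Fin n → A) (u : ℕ → A) : A :=
  (Matrix.fromBlocks (Matrix.of fun i j : Fin n => D^[(i : ℕ)] (θ j))
    (Matrix.of fun (i : Fin n) (_ : Unit) => u i)
    (Matrix.of fun (_ : Unit) (j : Fin n) => D^[n] (θ j))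
    (Matrix.of fun (_ _ : Unit) => u n)).det

/-! ### Crum–Darboux intertwining over a differential ring -/

section Crum

variable {A : Type*} [CommRing A]

/-- The commutator of L with ∇² has order at most m + 1, with top term 2c_m'∇^{m+1}; trading that
term for a multiple of L leaves order at most m. The remaining coefficients involve only D and c,
not ∇. -/
theorem monicOp_comm_sq {m : ℕ} (D nab : A →+ A)
    (hnab : ∀ a b, nab (a * b) = D a * b + a * nab b) (c : Fin (m + 1) → A) (g : A) :
    monicOp c nab (nab (nab g)) - nab (nab (monicOp c nab g))
      - 2 * D (c (Fin.last m)) * monicOp c nab g =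
    ∑ i : Fin (m + 1), (D (D (c i)) + 2 * (Fin.cons 0 (fun i : Fin m => D (c i.castSucc)) :
      Fin (m + 1) → A) i + 2 * D (c (Fin.last m)) * c i) * nab^[(i : ℕ)] g := by
  have hit : ∀ k, nab^[k] (nab (nab g)) = nab (nab (nab^[k] g)) := fun k => by
    rw [← Function.iterate_succ_apply, ← Function.iterate_succ_apply,
      Function.iterate_succ_apply', Function.iterate_succ_apply']
  have h2 : ∀ i : Fin (m + 1), nab (nab (c i * nab^[(i : ℕ)] g)) =
      D (D (c i)) * nab^[(i : ℕ)] g + 2 * (D (c i) * nab^[(i : ℕ) + 1] g) +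
        c i * nab (nab (nab^[(i : ℕ)] g)) := fun i => by
    rw [hnab, map_add, hnab, hnab, Function.iterate_succ_apply']; ring
  have h3 : ∑ i : Fin (m + 1), D (c i) * nab^[(i : ℕ) + 1] g =
      ∑ i : Fin (m + 1), (Fin.cons 0 (fun i : Fin m => D (c i.castSucc)) :
        Fin (m + 1) → A) i * nab^[(i : ℕ)] g + D (c (Fin.last m)) * nab^[m + 1] g := by
    rw [Fin.sum_univ_castSucc, Fin.sum_univ_succ (n := m)]
    simp
  simp only [monicOp, hit, map_sub, map_sum, h2, Finset.sum_add_distrib, add_mul, mul_sub]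
  simp only [mul_assoc, ← Finset.mul_sum, h3]
  ring

/-- For ∇ = D the remainder in `monicOp_comm_sq` kills every θ_j, because D² preserves their span
over constants; nondegeneracy then makes its coefficients zero. The same coefficients occur for the
twisted ∇, so its remainder vanishes as well. -/
theorem monicOp_intertwine {m : ℕ} (D nab : A →+ A)
    (hD : ∀ a b, D (a * b) = D a * b + a * D b)
    (hnab : ∀ a b, nab (a * b) = D a * b + a * nab b) (c θ : Fin (m + 1) → A)
    (hθ : ∀ j, monicOp c D (θ j) = 0)
    (hnd : ∀ b : Fin (m + 1) → A, (∀ j, ∑ i, b i * D^[(i : ℕ)] (θ j) = 0) → b = 0)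
    (N : Fin (m + 1) → Fin (m + 1) → A) (hN0 : ∀ k j, D (N k j) = 0)
    (hN : ∀ j, D (D (θ j)) = ∑ k, N k j * θ k) (f : A) :
    monicOp c nab (nab (nab f)) =
      nab (nab (monicOp c nab f)) + 2 * D (c (Fin.last m)) * monicOp c nab f := by
  have hiter : ∀ k (a b : A), D a = 0 → D^[k] (a * b) = a * D^[k] b := by
    intro k a b ha
    induction k with
    | zero => rfl
    | succ k ih => rw [Function.iterate_succ_apply', ih, hD, ha, Function.iterate_succ_apply']; simp
  have hiters : ∀ k (g : Fin (m + 1) → A), D^[k] (∑ i, g i) = ∑ i, D^[k] (g i) := by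
    intro k g
    induction k with
    | zero => rfl
    | succ k ih => simp only [Function.iterate_succ_apply', ih, map_sum]
  have hb := hnd _ fun j => (monicOp_comm_sq D D hD c (θ j)).symm.trans (by
    have : monicOp c D (D (D (θ j))) = ∑ k, N k j * monicOp c D (θ k) := by
      rw [hN]
      simp only [monicOp, hiters, hiter _ _ _ (hN0 _ _), mul_sub, Finset.sum_sub_distrib,
        Finset.mul_sum]
      rw [Finset.sum_comm]
      simp only [mul_left_comm]
    rw [this]
    simp [hθ])
  have h := monicOp_comm_sq D nab hnab c f
  have hz : ∀ i, _ = (0 : A) := fun i => congrFun hb i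
  simp only [hz, zero_mul, Finset.sum_const_zero] at h
  linear_combination h

theorem det_sum_deriv_row {n : ℕ} (D : A →+ A) (hD : ∀ a b, D (a * b) = D a * b + a * D b)
    (W : Matrix (Fin n) (Fin n) A) :
    D W.det = ∑ i, (W.updateRow i fun j => D (W i j)).det := by
  have h1 : D 1 = 0 := by simpa using hD 1 1
  have hz : ∀ z : ℤ, ∀ a, D ((z : A) * a) = z * D a := fun z a => by
    rw [← zsmul_eq_mul, map_zsmul, zsmul_eq_mul]
  have hp : ∀ (s : Finset (Fin n)) (g : Fin n → A),
      D (∏ i ∈ s, g i) = ∑ i ∈ s, D (g i) * ∏ k ∈ s.erase i, g k := by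
    intro s g
    induction s using Finset.induction_on with
    | empty => simp [h1]
    | insert a s ha ih =>
      rw [Finset.prod_insert ha, hD, ih, Finset.sum_insert ha, Finset.erase_insert ha,
        Finset.mul_sum]
      congr 1
      refine Finset.sum_congr rfl fun i hi => ?_
      have : i ≠ a := fun h => ha (h ▸ hi)
      rw [Finset.erase_insert_of_ne this.symm, Finset.prod_insert (by simp [ha])]
      ring
  rw [← Matrix.det_transpose W, Matrix.det_apply', map_sum]
  simp only [hz, hp, Matrix.transpose_apply, Finset.mul_sum]
  rw [Finset.sum_comm]
  refine Finset.sum_congr rfl fun i _ => ?_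
  rw [← Matrix.det_transpose, Matrix.det_apply']
  refine Finset.sum_congr rfl fun σ _ => ?_
  rw [← Finset.mul_prod_erase Finset.univ _ (Finset.mem_univ i)]
  simp only [Matrix.transpose_apply, Matrix.updateRow_self]
  congr 2
  refine Finset.prod_congr rfl fun k hk => ?_
  rw [Matrix.updateRow_ne (Finset.ne_of_mem_erase hk)]

/-- Abel's formula: differentiating any row but the last repeats the next row, and the
differentiated last row is the combination of all rows with coefficients c_i. -/
theorem deriv_wronskian_eq {m : ℕ} (D : A →+ A)
    (hD : ∀ a b, D (a * b) = D a * b + a * D b) (c θ : Fin (m + 1) → A)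
    (hθ : ∀ j, monicOp c D (θ j) = 0) :
    D (Matrix.of fun i j : Fin (m + 1) => D^[(i : ℕ)] (θ j)).det =
      c (Fin.last m) * (Matrix.of fun i j : Fin (m + 1) => D^[(i : ℕ)] (θ j)).det := by
  set W := Matrix.of fun i j : Fin (m + 1) => D^[(i : ℕ)] (θ j) with hW
  rw [det_sum_deriv_row D hD, Fin.sum_univ_castSucc, Finset.sum_eq_zero, zero_add]
  · have : (fun j => D (W (Fin.last m) j)) = ∑ i, c i • W i := by
      ext j
      have := hθ j
      rw [monicOp, sub_eq_zero, Function.iterate_succ_apply'] at this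
      simpa [hW, Finset.sum_apply] using this
    rw [this, Matrix.det_updateRow_sum]
    simp
  · intro i _
    refine Matrix.det_zero_of_row_eq (i := i.castSucc) (j := i.succ) ?_ ?_
    · exact (Fin.castSucc_lt_succ).ne
    · rw [Matrix.updateRow_self, Matrix.updateRow_ne (Fin.castSucc_lt_succ).ne']
      ext j
      simp [hW, ← Function.iterate_succ_apply' (f := D)]

/-- When τ is a unit, Cramer's rule gives the operator L that kills all θ_j, and the Schur
complement gives bordered determinant = τ · L f. The identity is then the intertwining relation
multiplied by τ², with c_m = τ'/τ. -/
theorem bordered_hirota_of_isUnit {m : ℕ} (D nab : A →+ A)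
    (hD : ∀ a b, D (a * b) = D a * b + a * D b)
    (hnab : ∀ a b, nab (a * b) = D a * b + a * nab b) (θ : Fin (m + 1) → A)
    (hτ : IsUnit (Matrix.of fun i j : Fin (m + 1) => D^[(i : ℕ)] (θ j)).det)
    (N : Fin (m + 1) → Fin (m + 1) → A) (hN0 : ∀ k j, D (N k j) = 0)
    (hN : ∀ j, D (D (θ j)) = ∑ k, N k j * θ k) (f : A) {τ : A}
    (hτ' : τ = (Matrix.of fun i j : Fin (m + 1) => D^[(i : ℕ)] (θ j)).det) :
    τ * nab (nab (borderedWronskian D θ fun i => nab^[i] f))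
      - 2 * D τ * nab (borderedWronskian D θ fun i => nab^[i] f)
      + D (D τ) * borderedWronskian D θ (fun i => nab^[i] f)
      = τ * borderedWronskian D θ (fun i => nab^[i] (nab (nab f))) := by
  set W := Matrix.of fun i j : Fin (m + 1) => D^[(i : ℕ)] (θ j) with hW
  have hWu : IsUnit W := (Matrix.isUnit_iff_isUnit_det _).2 hτ
  let _ : Invertible W := hWu.invertible
  set c : Fin (m + 1) → A := Matrix.vecMul (fun j => D^[m + 1] (θ j)) W⁻¹ with hc
  have hcW : Matrix.vecMul c W = fun j => D^[m + 1] (θ j) := by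
    rw [hc, Matrix.vecMul_vecMul, Matrix.nonsing_inv_mul _ hτ, Matrix.vecMul_one]
  have hθ : ∀ j, monicOp c D (θ j) = 0 := fun j => by
    have := congrFun hcW j
    rw [monicOp, ← this]
    simp [Matrix.vecMul, dotProduct, hW]
  have hbord : ∀ f, borderedWronskian D θ (fun i => nab^[i] f) = τ * monicOp c nab f := by
    intro f
    rw [borderedWronskian, ← hW, Matrix.det_fromBlocks₁₁, hτ', Matrix.det_unique (n := Unit)]
    congr 1
    rw [monicOp, Matrix.sub_apply, Matrix.of_apply, Matrix.mul_apply]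
    congr 1
    refine Finset.sum_congr rfl fun i _ => ?_
    rw [Matrix.mul_apply, hc, Matrix.of_apply]
    simp [Matrix.vecMul, dotProduct, Matrix.invOf_eq_nonsing_inv]
  have hL : D τ = c (Fin.last m) * τ := by rw [hτ']; exact deriv_wronskian_eq D hD c θ hθ
  have hI := monicOp_intertwine D nab hD hnab c θ hθ (fun b hb => by
    have : Matrix.vecMul b W = 0 := by
      ext j; simpa [Matrix.vecMul, dotProduct, hW] using hb j
    have h2 := congrArg (fun v => Matrix.vecMul v W⁻¹) this
    simpa [Matrix.vecMul_vecMul, Matrix.mul_nonsing_inv _ hτ] using h2) N hN0 hN f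
  simp only [hbord, hI, hnab, map_add, hL, hD]
  ring

end Crum

/-! ### Twisted derivatives and passage to Taylor series -/

/-- The twisted derivative `f ↦ f' + μ f`, i.e. `e^{-μz} d/dz e^{μz}`. -/
noncomputable def twDeriv (μ : ℂ) : ℂ[X] →+ ℂ[X] where
  toFun f := derivative f + C μ * f
  map_zero' := by simp
  map_add' f g := by simp; ring

theorem twDeriv_apply (μ : ℂ) (f : ℂ[X]) : twDeriv μ f = derivative f + C μ * f := rfl

/-- Taylor expansion of a polynomial at `p`, as a power series. -/
noncomputable def taylorPS (p : ℂ) : ℂ[X] →+* PowerSeries ℂ :=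
  (Polynomial.coeToPowerSeries.ringHom).comp (taylorAlgHom p : ℂ[X] →+* ℂ[X])

theorem taylorPS_apply (p : ℂ) (f : ℂ[X]) : taylorPS p f = ((taylor p f : ℂ[X]) : PowerSeries ℂ) :=
  rfl

theorem taylorPS_injective (p : ℂ) : Function.Injective (taylorPS p) :=
  (Polynomial.coe_injective ℂ).comp (taylor_injective p)

theorem taylorPS_derivative (p : ℂ) (f : ℂ[X]) :
    taylorPS p (derivative f) = PowerSeries.derivative ℂ (taylorPS p f) := by
  rw [taylorPS_apply, taylorPS_apply, PowerSeries.derivative_coe, taylor_apply, taylor_apply,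
    derivative_comp]
  simp

theorem constantCoeff_taylorPS (p : ℂ) (f : ℂ[X]) :
    PowerSeries.constantCoeff (taylorPS p f) = f.eval p := by
  rw [taylorPS_apply, Polynomial.constantCoeff_coe, taylor_coeff_zero]

/-- Expansion at a point where τ does not vanish is an injective ring homomorphism compatible with
the derivations, and it turns τ into a unit. -/
theorem bordered_hirota {m : ℕ} (μ : ℂ) (θ : Fin (m + 1) → ℂ[X]) (hτ : polyWronskian θ ≠ 0)
    (N : Fin (m + 1) → Fin (m + 1) → ℂ)
    (hN : ∀ j, derivative (derivative (θ j)) = ∑ k, C (N k j) * θ k) (f : ℂ[X]) :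
    polyWronskian θ * twDeriv μ (twDeriv μ
        (borderedWronskian derivative θ fun i => (twDeriv μ)^[i] f))
      - 2 * derivative (polyWronskian θ) * twDeriv μ
        (borderedWronskian derivative θ fun i => (twDeriv μ)^[i] f)
      + derivative (derivative (polyWronskian θ)) *
        borderedWronskian derivative θ (fun i => (twDeriv μ)^[i] f)
      = polyWronskian θ *
        borderedWronskian derivative θ (fun i => (twDeriv μ)^[i] (twDeriv μ (twDeriv μ f))) := by
  obtain ⟨p, hp⟩ : ∃ p, (polyWronskian θ).eval p ≠ 0 := by
    by_contra! h
    exact hτ (Polynomial.funext fun x => by simp [h])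
  apply taylorPS_injective p
  set D : PowerSeries ℂ →+ PowerSeries ℂ := (PowerSeries.derivative ℂ : _ →ₗ[ℂ] _).toAddMonoidHom
    with hDdef
  have hDa : ∀ g, D g = PowerSeries.derivative ℂ g := fun g => rfl
  let nab : PowerSeries ℂ →+ PowerSeries ℂ := D + AddMonoidHom.mulLeft (PowerSeries.C μ)
  have hnaba : ∀ g, nab g = D g + PowerSeries.C μ * g := fun g => rfl
  have hD : ∀ a b, D (a * b) = D a * b + a * D b := fun a b => by
    simp only [hDa, Derivation.leibniz, smul_eq_mul]; ring
  have htd : ∀ g, taylorPS p (derivative g) = D (taylorPS p g) := taylorPS_derivative p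
  have htC : ∀ a : ℂ, taylorPS p (C a) = PowerSeries.C a := fun a => by
    rw [taylorPS_apply, taylor_C, Polynomial.coe_C]
  have htn : ∀ g, taylorPS p (twDeriv μ g) = nab (taylorPS p g) := fun g => by
    rw [twDeriv_apply, map_add, htd, map_mul, htC, hnaba]
  have htdi : ∀ k g, taylorPS p (derivative^[k] g) = D^[k] (taylorPS p g) := fun k g => by
    induction k with
    | zero => rfl
    | succ k ih => rw [Function.iterate_succ_apply', htd, ih, Function.iterate_succ_apply']
  have htni : ∀ k g, taylorPS p ((twDeriv μ)^[k] g) = nab^[k] (taylorPS p g) := fun k g => by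
    induction k with
    | zero => rfl
    | succ k ih => rw [Function.iterate_succ_apply', htn, ih, Function.iterate_succ_apply']
  have hbord : ∀ g, taylorPS p (borderedWronskian derivative θ fun i => (twDeriv μ)^[i] g) =
      borderedWronskian D (fun j => taylorPS p (θ j)) fun i => nab^[i] (taylorPS p g) := fun g => by
    rw [borderedWronskian, RingHom.map_det, borderedWronskian]
    congr 1
    ext i j
    rcases i with i | i <;> rcases j with j | j <;>
      simp [htdi, htni, htd, htn]
  have hwr : taylorPS p (polyWronskian θ) =
      (Matrix.of fun i j : Fin (m + 1) => D^[(i : ℕ)] (taylorPS p (θ j))).det := by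
    rw [polyWronskian, RingHom.map_det]
    congr 1
    ext i j
    simp [htdi]
  have key := bordered_hirota_of_isUnit D nab hD (fun a b => by rw [hnaba, hnaba, hD]; ring)
    (fun j => taylorPS p (θ j)) (by
      rw [← hwr, PowerSeries.isUnit_iff_constantCoeff, constantCoeff_taylorPS]
      exact isUnit_iff_ne_zero.2 hp) (fun k j => PowerSeries.C (N k j))
    (fun k j => by rw [hDa, PowerSeries.derivative_C])
    (fun j => by rw [← htd, ← htd, hN]; simp [htC]) (taylorPS p f) hwr
  simp only [map_add, map_sub, map_mul, htn, htd, hbord, map_ofNat]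
  exact key

/-! ### Generating series of the θ_m and their reflection -/

theorem PowerSeries.derivative_mul' {R : Type*} [CommRing R] (f g : PowerSeries R) :
    PowerSeries.derivative R (f * g) =
      PowerSeries.derivative R f * g + f * PowerSeries.derivative R g := by
  rw [Derivation.leibniz, smul_eq_mul, smul_eq_mul]
  ring

theorem PowerSeries.derivative_exp_subst {R : Type*} [CommRing R] [Algebra ℚ R] {a : PowerSeries R}
    (ha : PowerSeries.constantCoeff a = 0) :
    PowerSeries.derivative R ((PowerSeries.exp R).subst a) =
      PowerSeries.derivative R a * (PowerSeries.exp R).subst a := by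
  rw [PowerSeries.derivative_subst (PowerSeries.HasSubst.of_constantCoeff_zero' ha),
    PowerSeries.derivative_exp, mul_comm]

theorem PowerSeries.constantCoeff_exp_subst {R : Type*} [CommRing R] [Algebra ℚ R]
    {a : PowerSeries R} (ha : PowerSeries.constantCoeff a = 0) :
    PowerSeries.constantCoeff ((PowerSeries.exp R).subst a) = 1 := by
  have hs := PowerSeries.HasSubst.of_constantCoeff_zero' ha
  have h : PowerSeries.exp R = 1 + (PowerSeries.exp R - 1) := by ring
  have h1 : (1 : PowerSeries R).subst a = 1 := by
    rw [← PowerSeries.coe_substAlgHom hs, map_one]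
  have h2 : PowerSeries.constantCoeff ((PowerSeries.exp R - 1).subst a) = 0 :=
    PowerSeries.constantCoeff_subst_eq_zero ha _ (by simp)
  rw [h, PowerSeries.subst_add hs, h1, map_add, h2]
  simp

/-- Uniqueness for first-order linear equations. Generating functions are compared below by matching
their logarithmic derivatives and constant terms. -/
theorem PowerSeries.eq_zero_of_derivative_eq_mul {R : Type*} [CommRing R] [IsAddTorsionFree R]
    {b F : PowerSeries R} (h : PowerSeries.derivative R F = b * F)
    (h0 : PowerSeries.constantCoeff F = 0) : F = 0 := by
  ext m
  induction m using Nat.strong_induction_on with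
  | _ m ih =>
    rcases m with _ | m
    · simpa using h0
    · have := congrArg (PowerSeries.coeff m) h
      rw [PowerSeries.coeff_derivative, PowerSeries.coeff_mul, Finset.sum_eq_zero] at this
      · have h2 : (m + 1) • PowerSeries.coeff (m + 1) F = 0 := by
          rw [nsmul_eq_mul, mul_comm]; exact_mod_cast this
        simpa using (smul_eq_zero_iff_right (Nat.succ_ne_zero m)).1 h2
      · intro p hp
        rw [ih p.2 (by have := Finset.HasAntidiagonal.mem_antidiagonal.1 hp; omega)]
        simp

/-- The series `∑ λ^(2i) = 1 / (1 - λ²)`. -/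
noncomputable def evenGeom (R : Type*) [CommRing R] : PowerSeries R :=
  PowerSeries.mk fun i => if Even i then 1 else 0

theorem evenGeom_mul (R : Type*) [CommRing R] :
    (1 - PowerSeries.X ^ 2) * evenGeom R = 1 := by
  ext m
  rw [sub_mul, one_mul, map_sub, PowerSeries.coeff_X_pow_mul', PowerSeries.coeff_one]
  rcases m with _ | _ | m
  · simp [evenGeom]
  · simp [evenGeom]
  · simp [evenGeom, Nat.even_add]

/-- The polynomials `θ_m(z + 1/2; K)` with `k_j = -1/2` for all `j`. -/
noncomputable def symmTheta (m : ℕ) : ℂ[X] :=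
  (amTheta (fun _ => -1 / 2) m).comp (X - C (-1 / 2))

noncomputable def symmThetaSeries : PowerSeries ℂ[X] := PowerSeries.mk symmTheta

theorem constantCoeff_amExponent (k : ℕ → ℂ) : PowerSeries.constantCoeff (amExponent k) = 0 := by
  rw [← PowerSeries.coeff_zero_eq_constantCoeff_apply]
  simp [amExponent]

theorem symmThetaSeries_eq : symmThetaSeries =
    PowerSeries.map (compRingHom (X - C (-1 / 2 : ℂ)))
      ((PowerSeries.exp ℂ[X]).subst (amExponent fun _ => -1 / 2)) := by
  ext1 m
  simp [symmThetaSeries, symmTheta, amTheta]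

theorem symmTheta_zero : symmTheta 0 = 1 := by
  have := PowerSeries.constantCoeff_exp_subst (constantCoeff_amExponent fun _ => -1 / 2)
  rw [← PowerSeries.coeff_zero_eq_constantCoeff_apply] at this
  rw [symmTheta, amTheta, this, one_comp]

theorem PowerSeries.derivative_map_ringHom {R S : Type*} [CommRing R] [CommRing S] (f : R →+* S) (g : PowerSeries R) :
    PowerSeries.derivative S (PowerSeries.map f g) =
      PowerSeries.map f (PowerSeries.derivative R g) := by
  ext m
  simp [PowerSeries.coeff_derivative]

/-- For k_j = -1/2 the exponent has λ-derivative z + (λ² + λ⁴ + ⋯)/2. The shift z ↦ z + 1/2 supplies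
the missing constant term of the geometric series. -/
theorem derivative_symmThetaSeries : PowerSeries.derivative ℂ[X] symmThetaSeries =
    (PowerSeries.C X + PowerSeries.C (C (1 / 2)) * evenGeom ℂ[X]) * symmThetaSeries := by
  rw [symmThetaSeries_eq, PowerSeries.derivative_map_ringHom,
    PowerSeries.derivative_exp_subst (constantCoeff_amExponent _), map_mul]
  congr 1
  ext1 m
  rw [PowerSeries.coeff_map, PowerSeries.coeff_derivative, map_add, PowerSeries.coeff_C_mul,
    evenGeom, PowerSeries.coeff_mk, amExponent, PowerSeries.coeff_mk, PowerSeries.coeff_C]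
  rcases m with _ | m
  · simp only [zero_add, Nat.cast_zero, mul_one, Even.zero, coe_compRingHom, X_comp, if_pos]
    rw [sub_eq_add_neg, ← C_neg]
    norm_num
  · have h1 : m + 1 + 1 ≠ 1 := by omega
    have h2 : Odd (m + 1 + 1) ↔ Even (m + 1) := by
      rw [Nat.odd_add_one, Nat.not_odd_iff_even]
    rw [if_neg h1, if_neg (Nat.succ_ne_zero m), zero_add]
    by_cases he : Even (m + 1)
    · rw [if_pos (h2.2 he), if_pos he, mul_one]
      have hne : ((m + 1 + 1 : ℕ) : ℂ) ≠ 0 := Nat.cast_ne_zero.2 (by omega)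
      have h3 : ((m + 1 : ℕ) : ℂ[X]) + 1 = C ((m + 1 + 1 : ℕ) : ℂ) := by simp
      rw [h3, ← C_neg, ← C_mul, coe_compRingHom]
      simp only [C_comp]
      congr 1
      field_simp
    · rw [if_neg (fun h => he (h2.1 h)), if_neg he]
      simp

/-- With Θ = ∑ θ_m λ^m, both ∑ θ_m' λ^m and λΘ solve K' = Θ + bK with zero constant term. -/
theorem derivative_symmTheta_succ (m : ℕ) : derivative (symmTheta (m + 1)) = symmTheta m := by
  set b : PowerSeries ℂ[X] := PowerSeries.C X + PowerSeries.C (C (1 / 2)) * evenGeom ℂ[X] with hb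
  set K : PowerSeries ℂ[X] := PowerSeries.mk fun m => derivative (symmTheta m) with hK
  have hbi : ∀ i, derivative (PowerSeries.coeff i b) = if i = 0 then 1 else 0 := by
    intro i
    rw [hb, map_add, PowerSeries.coeff_C_mul, PowerSeries.coeff_C, evenGeom, PowerSeries.coeff_mk]
    split_ifs <;> simp
  have hK' : PowerSeries.derivative ℂ[X] K = symmThetaSeries + b * K := by
    ext1 m
    have h := congrArg (fun F => derivative (PowerSeries.coeff m F)) derivative_symmThetaSeries
    rw [← hb, PowerSeries.coeff_derivative, PowerSeries.coeff_mul, derivative_sum] at h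
    simp only [derivative_mul, hbi, Finset.sum_add_distrib] at h
    rw [map_add, PowerSeries.coeff_derivative, PowerSeries.coeff_mul, hK, PowerSeries.coeff_mk]
    have h2 : derivative ((m : ℂ[X]) + 1) = 0 := by simp
    rw [h2, mul_zero, add_zero] at h
    rw [symmThetaSeries] at h ⊢
    simp only [PowerSeries.coeff_mk] at h ⊢
    rw [h]
    congr 1
    rw [Finset.sum_eq_single (0, m)]
    · simp
    · rintro ⟨i, j⟩ hij hne
      have : i ≠ 0 := by
        rintro rfl
        simp at hij
        exact hne (by rw [hij])
      simp [this]
    · simp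
  have hz := PowerSeries.eq_zero_of_derivative_eq_mul (b := b)
    (F := K - PowerSeries.X * symmThetaSeries) (by
      rw [map_sub, hK', PowerSeries.derivative_mul', derivative_symmThetaSeries, PowerSeries.derivative_X,
        ← hb]
      ring) (by
      rw [map_sub, map_mul, PowerSeries.constantCoeff_X, zero_mul, sub_zero, hK,
        ← PowerSeries.coeff_zero_eq_constantCoeff_apply, PowerSeries.coeff_mk, symmTheta_zero]
      simp)
  have := congrArg (PowerSeries.coeff (m + 1)) (sub_eq_zero.1 hz)
  rw [PowerSeries.coeff_succ_X_mul, hK, PowerSeries.coeff_mk, symmThetaSeries,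
    PowerSeries.coeff_mk] at this
  exact this

theorem natDegree_symmTheta_le (m : ℕ) : (symmTheta m).natDegree ≤ m := by
  induction m with
  | zero => simp [symmTheta_zero]
  | succ m ih =>
    by_contra! h
    have := natDegree_derivative (symmTheta (m + 1))
    rw [derivative_symmTheta_succ] at this
    omega

theorem coeff_symmTheta_self (m : ℕ) : (symmTheta m).coeff m = 1 / (m.factorial : ℂ) := by
  induction m with
  | zero => simp [symmTheta_zero]
  | succ m ih =>
    have h := congrArg (fun f => coeff f m) (derivative_symmTheta_succ m)
    simp only [coeff_derivative, ih] at h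
    have h1 : ((m : ℂ) + 1) ≠ 0 := Nat.cast_add_one_ne_zero m
    have h2 : (m.factorial : ℂ) ≠ 0 := Nat.cast_ne_zero.2 m.factorial_ne_zero
    rw [Nat.factorial_succ]
    push_cast
    rw [eq_div_iff h2] at h
    rw [eq_div_iff (mul_ne_zero h1 h2)]
    linear_combination h

/-- `(-1)^m θ_m(-z)`. -/
noncomputable def reflTheta (m : ℕ) : ℂ[X] := (-1) ^ m * (symmTheta m).comp (-X)

theorem derivative_reflThetaSeries :
    PowerSeries.derivative ℂ[X] (PowerSeries.mk reflTheta) =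
    (PowerSeries.C X - PowerSeries.C (C (1 / 2)) * evenGeom ℂ[X]) * PowerSeries.mk reflTheta := by
  have hr : PowerSeries.mk reflTheta =
      PowerSeries.rescale (-1) (PowerSeries.map (compRingHom (-X : ℂ[X])) symmThetaSeries) := by
    ext1 m
    simp [reflTheta, symmThetaSeries, PowerSeries.coeff_rescale]
  have hd : ∀ F : PowerSeries ℂ[X], PowerSeries.derivative ℂ[X] (PowerSeries.rescale (-1) F) =
      - PowerSeries.rescale (-1) (PowerSeries.derivative ℂ[X] F) := by
    intro F
    ext1 m
    rw [PowerSeries.coeff_derivative, PowerSeries.coeff_rescale, map_neg,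
      PowerSeries.coeff_rescale, PowerSeries.coeff_derivative, pow_succ]
    ring
  rw [hr, hd, PowerSeries.derivative_map_ringHom, derivative_symmThetaSeries, map_mul, map_mul, ← neg_mul]
  congr 1
  ext1 m
  rw [map_neg, PowerSeries.coeff_rescale, PowerSeries.coeff_map, map_add, map_sub,
    PowerSeries.coeff_C_mul, PowerSeries.coeff_C, evenGeom, PowerSeries.coeff_mk]
  by_cases h0 : m = 0
  · subst h0
    simp
    ring
  · by_cases he : Even m
    · simp [h0, he]
    · simp [h0, he]

/-- By logarithmic derivatives, the quotient of the series of θ_m by that of (-1)^m θ_m(-z) is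
√((1+λ)/(1-λ)), free of z. Multiplied by 1 - λ it becomes √(1-λ²), which is even. -/
theorem exists_even_series_mul_reflTheta : ∃ c : ℕ → ℂ, c 0 = 1 ∧ (∀ m, Odd m → c m = 0) ∧
    ∀ m, symmTheta (m + 1) - symmTheta m =
      ∑ p ∈ Finset.HasAntidiagonal.antidiagonal (m + 1), C (c p.1) * reflTheta p.2 := by
  -- This is log √(1-λ²); at i = 0 the entry is -1/0 = 0.
  set a : PowerSeries ℂ := PowerSeries.mk fun i => if Even i then -1 / (i : ℂ) else 0 with ha
  have ha0 : PowerSeries.constantCoeff a = 0 := by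
    rw [← PowerSeries.coeff_zero_eq_constantCoeff_apply]; simp [ha]
  have ha' : PowerSeries.derivative ℂ a = - (PowerSeries.X * evenGeom ℂ) := by
    ext m
    rw [PowerSeries.coeff_derivative, map_neg, ha, PowerSeries.coeff_mk]
    rcases m with _ | m
    · simp
    · rw [PowerSeries.coeff_succ_X_mul, evenGeom, PowerSeries.coeff_mk]
      have hne : ((m + 1 + 1 : ℕ) : ℂ) ≠ 0 := Nat.cast_ne_zero.2 (by omega)
      have : Even (m + 1 + 1) ↔ Even m := by simp [Nat.even_add]
      by_cases he : Even m
      · rw [if_pos (this.2 he), if_pos he]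
        push_cast at hne ⊢
        field_simp
      · rw [if_neg (fun h => he (this.1 h)), if_neg he]
        simp
  set c : PowerSeries ℂ := (PowerSeries.exp ℂ).subst a with hc
  have hc' : PowerSeries.derivative ℂ c = - (PowerSeries.X * evenGeom ℂ) * c := by
    rw [hc, PowerSeries.derivative_exp_subst ha0, ha']
  have hc0 : PowerSeries.coeff 0 c = 1 := by
    rw [PowerSeries.coeff_zero_eq_constantCoeff_apply]
    exact PowerSeries.constantCoeff_exp_subst ha0
  refine ⟨fun m => PowerSeries.coeff m c, hc0, ?_, ?_⟩
  · intro m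
    induction m using Nat.strong_induction_on with
    | _ m ih =>
      intro hm
      obtain ⟨k, rfl⟩ := hm
      have h := congrArg (PowerSeries.coeff (2 * k)) hc'
      rw [PowerSeries.coeff_derivative, PowerSeries.coeff_mul, Finset.sum_eq_zero] at h
      · refine (mul_eq_zero.1 h).resolve_right ?_
        exact Nat.cast_add_one_ne_zero _
      · rintro ⟨i, j⟩ hij
        rw [Finset.HasAntidiagonal.mem_antidiagonal] at hij
        simp only at hij ⊢
        rcases i with _ | i
        · simp
        · rw [map_neg, PowerSeries.coeff_succ_X_mul, evenGeom, PowerSeries.coeff_mk]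
          by_cases he : Even i
          · have := ih j (by omega) (by obtain ⟨s, rfl⟩ := he; exact ⟨k - s - 1, by omega⟩)
            simp only at this
            rw [this, mul_zero]
          · simp [he]
  · intro m
    set E := evenGeom ℂ[X] with hE
    have hEm : (1 - PowerSeries.X ^ 2) * E = 1 := evenGeom_mul _
    set Ch := PowerSeries.map (C : ℂ →+* ℂ[X]) c with hCh
    have hCh' : PowerSeries.derivative ℂ[X] Ch = - (PowerSeries.X * E) * Ch := by
      have hEC : PowerSeries.map (C : ℂ →+* ℂ[X]) (evenGeom ℂ) = E := by
        ext1 m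
        rw [hE, PowerSeries.coeff_map, evenGeom, evenGeom, PowerSeries.coeff_mk,
          PowerSeries.coeff_mk]
        split_ifs <;> simp
      rw [hCh, PowerSeries.derivative_map_ringHom, hc', map_mul, map_neg, map_mul,
        PowerSeries.map_X, hEC]
    have hz := PowerSeries.eq_zero_of_derivative_eq_mul
      (b := PowerSeries.C X - PowerSeries.C (C (1 / 2)) * E - PowerSeries.X * E)
      (F := (1 - PowerSeries.X) * symmThetaSeries - Ch * PowerSeries.mk reflTheta) (by
        rw [map_sub, PowerSeries.derivative_mul', PowerSeries.derivative_mul', hCh', derivative_reflThetaSeries,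
          derivative_symmThetaSeries, map_sub, PowerSeries.derivative_one,
          PowerSeries.derivative_X, ← hE]
        have h2 : PowerSeries.C (C (1 / 2)) * 2 = (1 : PowerSeries ℂ[X]) := by
          have : (2 : PowerSeries ℂ[X]) = PowerSeries.C (C 2) := by
            rw [map_ofNat, map_ofNat]
          rw [this, ← map_mul, ← C_mul]
          norm_num
        linear_combination (symmThetaSeries) * hEm + symmThetaSeries * (1 - PowerSeries.X) * E * h2) (by
        rw [map_sub, map_mul, map_mul, map_sub, PowerSeries.constantCoeff_X, map_one,
          ← PowerSeries.coeff_zero_eq_constantCoeff_apply,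
          ← PowerSeries.coeff_zero_eq_constantCoeff_apply,
          ← PowerSeries.coeff_zero_eq_constantCoeff_apply, hCh, PowerSeries.coeff_map, hc0,
          PowerSeries.coeff_mk, symmThetaSeries, PowerSeries.coeff_mk, reflTheta, symmTheta_zero]
        simp)
    have h := congrArg (PowerSeries.coeff (m + 1)) (sub_eq_zero.1 hz)
    rw [sub_mul, one_mul, map_sub, PowerSeries.coeff_succ_X_mul, PowerSeries.coeff_mul,
      symmThetaSeries, PowerSeries.coeff_mk, PowerSeries.coeff_mk] at h
    rw [h]
    exact Finset.sum_congr rfl fun p _ => by rw [hCh, PowerSeries.coeff_map, PowerSeries.coeff_mk]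

/-! ### Degrees and leading coefficients of Wronskians -/

theorem polyWronskian_comp {n : ℕ} (f : Fin n → ℂ[X]) (a : ℂ) :
    (polyWronskian f).comp (X - C a) = polyWronskian fun j => (f j).comp (X - C a) := by
  have h : ∀ k (g : ℂ[X]), derivative^[k] (g.comp (X - C a)) = (derivative^[k] g).comp (X - C a) := by
    intro k g
    induction k with
    | zero => rfl
    | succ k ih => rw [Function.iterate_succ_apply', ih, Function.iterate_succ_apply',
        derivative_comp]; simp
  rw [← coe_compRingHom_apply, polyWronskian, RingHom.map_det, polyWronskian]
  congr 1
  ext1 i j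
  simp [h]

theorem exists_symmAdlerMoser_eq (n : ℕ) : ∃ s : ℂ, s ≠ 0 ∧ symmAdlerMoser n =
    C s * polyWronskian fun j : Fin n => symmTheta (2 * (j : ℕ) + 1) := by
  refine ⟨∏ j ∈ Finset.Icc 1 n, (2 * (j : ℂ) + 1) ^ (n - j), ?_, ?_⟩
  · refine Finset.prod_ne_zero_iff.2 fun j _ => pow_ne_zero _ ?_
    exact_mod_cast Nat.succ_ne_zero (2 * j)
  · rw [symmAdlerMoser, adlerMoser, mul_comp, C_comp, polyWronskian_comp]
    rfl

theorem Polynomial.coeff_prod_sum_natDegree_le {ι : Type*} (s : Finset ι) (g : ι → ℂ[X]) (d : ι → ℕ)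
    (h : ∀ i ∈ s, (g i).natDegree ≤ d i) :
    (∏ i ∈ s, g i).natDegree ≤ ∑ i ∈ s, d i ∧
      (∏ i ∈ s, g i).coeff (∑ i ∈ s, d i) = ∏ i ∈ s, (g i).coeff (d i) := by
  classical
  induction s using Finset.induction_on with
  | empty => simp
  | insert a s ha ih =>
    obtain ⟨h1, h2⟩ := ih fun i hi => h i (Finset.mem_insert_of_mem hi)
    have h3 := h a (Finset.mem_insert_self a s)
    rw [Finset.prod_insert ha, Finset.sum_insert ha, Finset.prod_insert ha,
      coeff_mul_add_eq_of_natDegree_le h3 h1, h2]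
    exact ⟨natDegree_mul_le.trans (add_le_add h3 h1), rfl⟩

theorem Polynomial.coeff_det_sum_natDegree_le {n : ℕ} (W : Matrix (Fin n) (Fin n) ℂ[X])
    (d : Fin n → ℕ) (h : ∀ i j, (W i j).natDegree ≤ d j) :
    W.det.natDegree ≤ ∑ j, d j ∧
      W.det.coeff (∑ j, d j) = (Matrix.of fun i j => (W i j).coeff (d j)).det := by
  have hp := fun σ : Equiv.Perm (Fin n) =>
    Polynomial.coeff_prod_sum_natDegree_le Finset.univ (fun i => W (σ i) i) d fun i _ => h _ _
  rw [Matrix.det_apply', Matrix.det_apply']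
  constructor
  · refine natDegree_sum_le_of_forall_le _ _ fun σ _ => ?_
    refine natDegree_mul_le.trans ?_
    rw [natDegree_intCast, zero_add]
    exact (hp σ).1
  · rw [finsetSum_coeff]
    refine Finset.sum_congr rfl fun σ _ => ?_
    rw [← C_eq_intCast, coeff_C_mul, (hp σ).2]
    simp

theorem natDegree_X_pow_mul_iterate_derivative_le (f : ℂ[X]) {d : ℕ} (hf : f.natDegree ≤ d)
    (i : ℕ) : (X ^ i * derivative^[i] f).natDegree ≤ d := by
  rcases le_or_gt i f.natDegree with h | h
  · refine natDegree_mul_le.trans ?_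
    have := natDegree_iterate_derivative f i
    rw [natDegree_X_pow]
    omega
  · rw [iterate_derivative_eq_zero h]
    simp

theorem coeff_X_pow_mul_iterate_derivative (f : ℂ[X]) (d i : ℕ) :
    (X ^ i * derivative^[i] f).coeff d = (d.descFactorial i : ℂ) * f.coeff d := by
  rw [coeff_X_pow_mul']
  split_ifs with h
  · rw [coeff_iterate_derivative, Nat.sub_add_cancel h, nsmul_eq_mul]
  · rw [Nat.descFactorial_of_lt (by omega)]
    simp

/-- Multiplying row i by X^i undoes the drop in degree caused by differentiation. Column j then has
degree at most d_j throughout, and the top coefficient is the determinant of the top coefficients.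
-/
theorem polyWronskian_natDegree_coeff {n : ℕ} (f : Fin n → ℂ[X]) (d : Fin n → ℕ)
    (hf : ∀ j, (f j).natDegree ≤ d j) :
    (X ^ (∑ i : Fin n, (i : ℕ)) * polyWronskian f).natDegree ≤ ∑ j, d j ∧
      (X ^ (∑ i : Fin n, (i : ℕ)) * polyWronskian f).coeff (∑ j, d j) =
        (Matrix.of fun i j : Fin n => ((d j).descFactorial i : ℂ) * (f j).coeff (d j)).det := by
  have h : X ^ (∑ i : Fin n, (i : ℕ)) * polyWronskian f =
      (Matrix.of fun i j : Fin n => X ^ (i : ℕ) * derivative^[(i : ℕ)] (f j)).det := by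
    rw [polyWronskian, ← Finset.prod_pow_eq_pow_sum, ← Matrix.det_mul_column]
    rfl
  rw [h]
  have := Polynomial.coeff_det_sum_natDegree_le
    (Matrix.of fun i j : Fin n => X ^ (i : ℕ) * derivative^[(i : ℕ)] (f j)) d
    fun i j => by
      rw [Matrix.of_apply]
      exact natDegree_X_pow_mul_iterate_derivative_le (f j) (hf j) i
  simpa only [Matrix.of_apply, coeff_X_pow_mul_iterate_derivative] using this

/-- The i-th descending factorial is a monic polynomial of degree i in d_j, so this is a Vandermonde
determinant up to the factors l_j. -/
theorem det_descFactorial_ne_zero {n : ℕ} (d : Fin n → ℕ) (hd : Function.Injective d)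
    (l : Fin n → ℂ) (hl : ∀ j, l j ≠ 0) :
    (Matrix.of fun i j : Fin n => ((d j).descFactorial i : ℂ) * l j).det ≠ 0 := by
  have h1 : (Matrix.of fun i j : Fin n => ((d j).descFactorial i : ℂ) * l j).det =
      (∏ j, l j) * (Matrix.of fun i j : Fin n => ((d j).descFactorial i : ℂ)).det := by
    rw [← Matrix.det_mul_row]
    congr 1
    ext i j
    simp [mul_comm]
  have h2 := Matrix.det_eval_matrixOfPolynomials_eq_det_vandermonde (fun j => (d j : ℂ))
    (fun i : Fin n => descPochhammer ℂ i)
    (fun i => descPochhammer_natDegree ℂ i) (fun i => monic_descPochhammer ℂ i)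
  rw [h1, ← Matrix.det_transpose]
  refine mul_ne_zero (Finset.prod_ne_zero_iff.2 fun j _ => hl j) ?_
  have h3 : (Matrix.of fun i j : Fin n => ((d j).descFactorial i : ℂ)).transpose =
      Matrix.of fun i j : Fin n => ((descPochhammer ℂ j).eval (d i : ℂ)) := by
    ext i j
    simp [descPochhammer_eval_eq_descFactorial]
  rw [h3, ← h2, Matrix.det_vandermonde_ne_zero_iff]
  exact Nat.cast_injective.comp hd

/-- The number `0 + 1 + ⋯ + (n - 1)`. -/
def triangle (n : ℕ) : ℕ := ∑ i ∈ Finset.range n, i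

theorem triangle_succ (n : ℕ) : triangle (n + 1) = triangle n + n := Finset.sum_range_succ _ _

theorem triangle_succ_eq (n : ℕ) : triangle (n + 1) = n * (n + 1) / 2 := by
  rw [triangle, Finset.sum_range_id, Nat.add_sub_cancel, mul_comm]

theorem two_mul_triangle_add (n : ℕ) : 2 * triangle n + n = n * n := by
  induction n with
  | zero => rfl
  | succ n ih => rw [triangle_succ]; linarith

theorem sum_fin_eq_triangle (n : ℕ) : ∑ i : Fin n, (i : ℕ) = triangle n :=
  Fin.sum_univ_eq_sum_range (fun i => i) n

theorem sum_fin_odd (n : ℕ) : ∑ j : Fin n, (2 * (j : ℕ) + 1) = 2 * triangle n + n := by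
  rw [Finset.sum_add_distrib, ← Finset.mul_sum, sum_fin_eq_triangle]
  simp

theorem borderedWronskian_eq_det_snoc {A : Type*} [CommRing A] {n : ℕ} (D : A → A) (θ : Fin n → A)
    (u : ℕ → A) : borderedWronskian D θ u =
      (Matrix.of fun i : Fin (n + 1) =>
        (Fin.snoc (fun j => D^[(i : ℕ)] (θ j)) (u i) : Fin (n + 1) → A)).det := by
  let e : Fin n ⊕ Unit ≃ Fin (n + 1) :=
    (Equiv.optionEquivSumPUnit (Fin n)).symm.trans finSuccEquivLast.symm
  have e1 : ∀ i, e (Sum.inl i) = Fin.castSucc i := fun i => by simp [e]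
  have e2 : ∀ i, e (Sum.inr i) = Fin.last n := fun i => by simp [e]
  rw [borderedWronskian, ← Matrix.det_submatrix_equiv_self e]
  congr 1
  ext i j
  rcases i with i | i <;> rcases j with j | j <;> simp [e1, e2]

/-! ### The τ functions and their bilinear equations -/

/-- The polynomials `θ_1, θ_3, …, θ_{2n-1}`. -/
noncomputable def oddTheta (n : ℕ) (j : Fin n) : ℂ[X] := symmTheta (2 * (j : ℕ) + 1)

/-- `W(θ_1, θ_3, …, θ_{2n-1})`. -/
noncomputable def symmTau (n : ℕ) : ℂ[X] := polyWronskian (oddTheta n)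

/-- `W(θ_1, θ_3, …, θ_{2n-1}, θ_k)`. -/
noncomputable def symmTauExt (n k : ℕ) : ℂ[X] :=
  borderedWronskian derivative (oddTheta n) fun i => derivative^[i] (symmTheta k)

theorem symmTauExt_eq (n k : ℕ) :
    symmTauExt n k = polyWronskian (Fin.snoc (oddTheta n) (symmTheta k) : Fin (n + 1) → ℂ[X]) := by
  rw [symmTauExt, borderedWronskian_eq_det_snoc, polyWronskian]
  congr 1
  ext1 i j
  refine Fin.lastCases ?_ (fun j => ?_) j <;> simp

theorem natDegree_oddTheta_le {n : ℕ} (j : Fin n) : (oddTheta n j).natDegree ≤ 2 * (j : ℕ) + 1 :=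
  natDegree_symmTheta_le _

theorem coeff_oddTheta_ne_zero {n : ℕ} (j : Fin n) : (oddTheta n j).coeff (2 * (j : ℕ) + 1) ≠ 0 := by
  rw [oddTheta, coeff_symmTheta_self]
  exact one_div_ne_zero (Nat.cast_ne_zero.2 (Nat.factorial_ne_zero _))

theorem natDegree_le_of_X_pow_mul {f : ℂ[X]} {s d : ℕ} (h : (X ^ s * f).natDegree ≤ d + s) :
    f.natDegree ≤ d := by
  by_cases hf : f = 0
  · simp [hf]
  · rw [natDegree_X_pow_mul _ hf] at h
    omega

theorem natDegree_symmTau_le (n : ℕ) : (symmTau n).natDegree ≤ triangle (n + 1) := by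
  have h := (polyWronskian_natDegree_coeff (oddTheta n) _ natDegree_oddTheta_le).1
  rw [sum_fin_odd, sum_fin_eq_triangle] at h
  refine natDegree_le_of_X_pow_mul (s := triangle n) (h.trans ?_)
  rw [triangle_succ]
  omega

theorem coeff_symmTau_ne_zero (n : ℕ) : (symmTau n).coeff (triangle (n + 1)) ≠ 0 := by
  have h := (polyWronskian_natDegree_coeff (oddTheta n) _ natDegree_oddTheta_le).2
  rw [sum_fin_odd, sum_fin_eq_triangle,
    show 2 * triangle n + n = triangle (n + 1) + triangle n by rw [triangle_succ]; ring,
    coeff_X_pow_mul] at h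
  rw [symmTau, h]
  refine det_descFactorial_ne_zero _ ?_ _ coeff_oddTheta_ne_zero
  intro i j hij
  ext
  simpa using hij

theorem symmTau_ne_zero (n : ℕ) : symmTau n ≠ 0 := fun h =>
  coeff_symmTau_ne_zero n (by rw [h, coeff_zero])

theorem natDegree_snoc_le (n k : ℕ) (j : Fin (n + 1)) :
    ((Fin.snoc (oddTheta n) (symmTheta k) : Fin (n + 1) → ℂ[X]) j).natDegree ≤
      (Fin.snoc (fun j : Fin n => 2 * (j : ℕ) + 1) k : Fin (n + 1) → ℕ) j := by
  refine Fin.lastCases ?_ (fun j => ?_) j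
  · simpa using natDegree_symmTheta_le k
  · simpa using natDegree_oddTheta_le j

theorem sum_snoc_odd (n k : ℕ) :
    ∑ j, (Fin.snoc (fun j : Fin n => 2 * (j : ℕ) + 1) k : Fin (n + 1) → ℕ) j =
      triangle n + k + triangle (n + 1) := by
  rw [Fin.sum_univ_castSucc]
  simp only [Fin.snoc_castSucc, Fin.snoc_last]
  rw [sum_fin_odd, triangle_succ]
  ring

theorem natDegree_symmTauExt_le (n k : ℕ) : (symmTauExt n k).natDegree ≤ triangle n + k := by
  have h := (polyWronskian_natDegree_coeff _ _ (natDegree_snoc_le n k)).1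
  rw [sum_snoc_odd, sum_fin_eq_triangle, ← symmTauExt_eq] at h
  exact natDegree_le_of_X_pow_mul h

/-- The leading coefficient (possibly zero) of `W(θ_1, θ_3, …, θ_{2n-1}, θ_k)`. -/
noncomputable def extCoeff (n k : ℕ) : ℂ := (symmTauExt n k).coeff (triangle n + k)

theorem extCoeff_ne_zero (n k : ℕ) (hk : ∀ j < n, k ≠ 2 * j + 1) : extCoeff n k ≠ 0 := by
  have h := (polyWronskian_natDegree_coeff _ _ (natDegree_snoc_le n k)).2
  rw [sum_snoc_odd, sum_fin_eq_triangle, ← symmTauExt_eq, coeff_X_pow_mul] at h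
  rw [extCoeff, h]
  refine det_descFactorial_ne_zero _ ?_ _ ?_
  · rw [Fin.snoc_injective_iff]
    refine ⟨fun i j hij => ?_, ?_⟩
    · ext
      simpa using hij
    · rintro ⟨j, hj⟩
      exact hk j j.2 hj.symm
  · intro j
    refine Fin.lastCases ?_ (fun j => ?_) j
    · rw [Fin.snoc_last, Fin.snoc_last, coeff_symmTheta_self]
      exact one_div_ne_zero (Nat.cast_ne_zero.2 (Nat.factorial_ne_zero _))
    · rw [Fin.snoc_castSucc, Fin.snoc_castSucc]
      exact coeff_oddTheta_ne_zero j

theorem symmTauExt_eq_zero (n j : ℕ) (hj : j < n) : symmTauExt n (2 * j + 1) = 0 := by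
  rw [symmTauExt_eq, polyWronskian]
  refine Matrix.det_zero_of_column_eq (i := Fin.castSucc ⟨j, hj⟩) (j := Fin.last n)
    (Fin.castSucc_lt_last _).ne fun i => ?_
  rw [Matrix.of_apply, Matrix.of_apply, Fin.snoc_castSucc, Fin.snoc_last, oddTheta]

theorem derivative_derivative_symmTheta (k : ℕ) :
    derivative (derivative (symmTheta (k + 2))) = symmTheta k := by
  rw [derivative_symmTheta_succ, derivative_symmTheta_succ]

theorem derivative_derivative_oddTheta (m : ℕ) (j : Fin (m + 1)) :
    derivative (derivative (oddTheta (m + 1) j)) =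
      ∑ k : Fin (m + 1), C (if (k : ℕ) + 1 = j then 1 else 0) * oddTheta (m + 1) k := by
  rcases j with ⟨j, hj⟩
  rcases j with _ | j
  · have : derivative (derivative (oddTheta (m + 1) ⟨0, hj⟩)) = 0 := by
      rw [oddTheta]
      simp [derivative_symmTheta_succ, symmTheta_zero]
    rw [this, Finset.sum_eq_zero]
    intro k _
    simp
  · rw [Finset.sum_eq_single ⟨j, by omega⟩]
    · have := derivative_derivative_symmTheta (2 * j + 1)
      simpa [oddTheta, mul_add] using this
    · intro k _ hk
      have : ¬ ((k : ℕ) + 1 = j + 1) := fun h => hk (by ext; simpa using h)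
      rw [if_neg this, C_0, zero_mul]
    · simp

theorem twDeriv_zero_apply (f : ℂ[X]) : twDeriv 0 f = derivative f := by
  simp [twDeriv_apply]

theorem coe_twDeriv_zero : ⇑(twDeriv 0) = derivative := funext twDeriv_zero_apply

theorem symmTauExt_hirota (m k : ℕ) :
    symmTau (m + 1) * derivative (derivative (symmTauExt (m + 1) (k + 2)))
      - 2 * derivative (symmTau (m + 1)) * derivative (symmTauExt (m + 1) (k + 2))
      + derivative (derivative (symmTau (m + 1))) * symmTauExt (m + 1) (k + 2)
      = symmTau (m + 1) * symmTauExt (m + 1) k := by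
  have h := bordered_hirota 0 (oddTheta (m + 1)) (symmTau_ne_zero _) _
    (derivative_derivative_oddTheta m) (symmTheta (k + 2))
  simp only [coe_twDeriv_zero, derivative_derivative_symmTheta] at h
  exact h

theorem symmTauExt_hirota_zero (m k : ℕ) (hk : k < 2) :
    symmTau (m + 1) * derivative (derivative (symmTauExt (m + 1) k))
      - 2 * derivative (symmTau (m + 1)) * derivative (symmTauExt (m + 1) k)
      + derivative (derivative (symmTau (m + 1))) * symmTauExt (m + 1) k = 0 := by
  have h := bordered_hirota 0 (oddTheta (m + 1)) (symmTau_ne_zero _) _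
    (derivative_derivative_oddTheta m) (symmTheta k)
  have h0 : derivative (derivative (symmTheta k)) = 0 := by
    interval_cases k <;> simp [derivative_symmTheta_succ, symmTheta_zero]
  simp only [coe_twDeriv_zero, h0] at h
  have h1 : borderedWronskian derivative (oddTheta (m + 1)) (fun i => derivative^[i] 0) = 0 := by
    rw [borderedWronskian_eq_det_snoc]
    refine Matrix.det_eq_zero_of_column_eq_zero (Fin.last _) fun i => ?_
    simp
  rw [h1, mul_zero] at h
  exact h

/-- The recurrence is the coefficient of top possible degree in the Hirota equation. -/
theorem extCoeff_recurrence (m k : ℕ) :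
    ((k : ℂ) + 2) * ((k : ℂ) + 2 - (2 * (m + 1) + 1)) * extCoeff (m + 1) (k + 2) =
      extCoeff (m + 1) k := by
  have h := congrArg (fun f => (X ^ 2 * f).coeff (triangle (m + 1 + 1) + (triangle (m + 1) + (k + 2))))
    (symmTauExt_hirota m k)
  set τ := symmTau (m + 1)
  set T := symmTauExt (m + 1) (k + 2) with hT
  have e1 : X ^ 2 * (τ * derivative (derivative T) - 2 * derivative τ * derivative T
      + derivative (derivative τ) * T) = (X ^ 0 * derivative^[0] τ) * (X ^ 2 * derivative^[2] T)
      - C 2 * ((X ^ 1 * derivative^[1] τ) * (X ^ 1 * derivative^[1] T))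
      + (X ^ 2 * derivative^[2] τ) * (X ^ 0 * derivative^[0] T) := by
    simp only [Function.iterate_succ, Function.iterate_zero, Function.comp, id, map_ofNat]
    ring
  have e2 : X ^ 2 * (τ * symmTauExt (m + 1) k) = τ * (X ^ 2 * symmTauExt (m + 1) k) := by ring
  have hτd := natDegree_X_pow_mul_iterate_derivative_le τ (natDegree_symmTau_le (m + 1))
  have hTd := natDegree_X_pow_mul_iterate_derivative_le T (natDegree_symmTauExt_le (m + 1) (k + 2))
  have hB : (X ^ 2 * symmTauExt (m + 1) k).natDegree ≤ triangle (m + 1) + (k + 2) := by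
    refine natDegree_mul_le.trans ?_
    rw [natDegree_X_pow]
    have := natDegree_symmTauExt_le (m + 1) k
    omega
  simp only [e1, e2] at h
  rw [coeff_add, coeff_sub, coeff_C_mul, coeff_mul_add_eq_of_natDegree_le (hτd 0) (hTd 2),
    coeff_mul_add_eq_of_natDegree_le (hτd 1) (hTd 1),
    coeff_mul_add_eq_of_natDegree_le (hτd 2) (hTd 0),
    coeff_mul_add_eq_of_natDegree_le (natDegree_symmTau_le (m + 1)) hB] at h
  simp only [coeff_X_pow_mul_iterate_derivative] at h
  have hE : T.coeff (triangle (m + 1) + (k + 2)) = extCoeff (m + 1) (k + 2) := rfl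
  have hE' : (X ^ 2 * symmTauExt (m + 1) k).coeff (triangle (m + 1) + (k + 2)) =
      extCoeff (m + 1) k := by
    rw [← add_assoc, coeff_X_pow_mul, extCoeff]
  have hd2 : ∀ d : ℕ, (d.descFactorial 2 : ℂ) = d * (d - 1) := fun d => by
    rcases d with _ | d
    · simp
    · simp [Nat.descFactorial_succ]
      ring
  simp only [hE, hE', hd2, Nat.descFactorial_zero, Nat.descFactorial_one, Nat.cast_one, one_mul] at h
  refine mul_left_cancel₀ (coeff_symmTau_ne_zero (m + 1)) ?_
  rw [← h]
  -- With p = deg τ and q the degree bound of T, the bilinear form contributes (q - p)² - (q + p).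
  -- With n = m + 1, the relation 2(0 + ⋯ + (n-1)) + n = n² makes this factor as (k+2)(k+2-(2n+1)).
  have h3 : (2 * triangle (m + 1) + (m + 1) : ℂ) = (m + 1) * (m + 1) := by
    exact_mod_cast two_mul_triangle_add (m + 1)
  have h4 : (triangle (m + 1 + 1) : ℂ) = triangle (m + 1) + (m + 1) := by
    exact_mod_cast triangle_succ (m + 1)
  rw [h4]
  push_cast
  linear_combination ((symmTau (m + 1)).coeff (triangle (m + 1 + 1)) * extCoeff (m + 1) (k + 2)) * h3

theorem iterate_derivative_comp_neg_X (i : ℕ) (f : ℂ[X]) :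
    derivative^[i] (f.comp (-X)) = (-1) ^ i * (derivative^[i] f).comp (-X) := by
  induction i with
  | zero => simp
  | succ i ih =>
    have h1 : derivative ((-1 : ℂ[X]) ^ i) = 0 := by
      rw [← C_1, ← C_neg, ← C_pow, derivative_C]
    rw [Function.iterate_succ_apply', ih, Function.iterate_succ_apply', derivative_mul,
      derivative_comp, h1, derivative_neg, derivative_X, pow_succ]
    ring

/-- A lower unitriangular change of columns turns `θ_j - θ_j'` into `(-1)^j θ_j(-z)`. -/
theorem exists_bordered_one_eq (m : ℕ) : ∃ s : ℂ, s ≠ 0 ∧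
    borderedWronskian derivative (oddTheta m) (fun i => (twDeriv 1)^[i] 1) =
      C s * (symmTau m).comp (-X) := by
  obtain ⟨c, hc0, hc1, hc⟩ := exists_even_series_mul_reflTheta
  have hone : ∀ i, (twDeriv 1)^[i] 1 = 1 := fun i => by
    induction i with
    | zero => rfl
    | succ i ih => rw [Function.iterate_succ_apply', ih, twDeriv_apply]; simp
  -- In the sum over p + q = 2j + 1 only even p = 2(j - k) survive, so only the odd indices q = 2k +
  -- 1 occur. Hence U is triangular with diagonal entries -c_0 = -1.
  set U : Matrix (Fin m) (Fin m) ℂ[X] :=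
    Matrix.of fun k j => if (k : ℕ) ≤ j then C (-c (2 * ((j : ℕ) - k))) else 0 with hU
  have hdiff : ∀ j : Fin m, derivative (oddTheta m j) - oddTheta m j =
      ∑ k : Fin m, reflTheta (2 * (k : ℕ) + 1) * U k j := by
    intro j
    have h := hc (2 * (j : ℕ))
    rw [oddTheta, derivative_symmTheta_succ, ← neg_sub, h, ← Finset.sum_neg_distrib]
    have h2 : ∑ k : Fin m, reflTheta (2 * (k : ℕ) + 1) * U k j =
        ∑ k ∈ Finset.univ.filter fun k : Fin m => (k : ℕ) ≤ j,
          reflTheta (2 * (k : ℕ) + 1) * C (-c (2 * ((j : ℕ) - k))) := by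
      rw [Finset.sum_filter]
      exact Finset.sum_congr rfl fun k _ => by rw [hU, Matrix.of_apply, mul_ite, mul_zero]
    rw [h2]
    refine (Finset.sum_of_injOn (fun k : Fin m => (2 * ((j : ℕ) - k), 2 * (k : ℕ) + 1))
      ?_ ?_ ?_ ?_).symm
    · intro k _ l _ hkl
      ext
      simpa using (Prod.ext_iff.1 hkl).2
    · intro k hk
      simp only [Finset.coe_filter, Finset.mem_univ, true_and, Set.mem_ofPred_eq] at hk
      simp only [Finset.mem_coe, Finset.HasAntidiagonal.mem_antidiagonal]
      omega
    · rintro ⟨p, q⟩ hpq hn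
      rw [Finset.HasAntidiagonal.mem_antidiagonal] at hpq
      simp only at hpq ⊢
      rcases Nat.even_or_odd p with ⟨r, hr⟩ | hp
      · refine absurd ⟨⟨(j : ℕ) - r, by omega⟩, ?_, ?_⟩ hn
        · simp only [Finset.coe_filter, Finset.mem_univ, true_and, Set.mem_ofPred_eq]
          omega
        · simp only [Prod.mk.injEq]
          omega
      · rw [hc1 p hp, C_0, zero_mul, neg_zero]
    · intro k _
      simp only [C_neg]
      ring
  have hUdet : U.det = (-1) ^ m := by
    rw [Matrix.det_of_isUpperTriangular]
    · simp [hU, hc0]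
    · intro k j hkj
      simp only [hU, Matrix.of_apply]
      exact if_neg (not_le.2 hkj)
  have hR : (Matrix.of fun i k : Fin m => derivative^[(i : ℕ)] (reflTheta (2 * (k : ℕ) + 1))).det =
      (∏ i : Fin m, (-1) ^ (i : ℕ)) * ((-1) ^ m * (symmTau m).comp (-X)) := by
    have h1 : (symmTau m).comp (-X) =
        (Matrix.of fun i k : Fin m => (derivative^[(i : ℕ)] (oddTheta m k)).comp (-X)).det := by
      rw [← coe_compRingHom_apply, symmTau, polyWronskian, RingHom.map_det]
      rfl
    have h2 : ((-1 : ℂ[X]) ^ m) = ∏ _k : Fin m, (-1 : ℂ[X]) := by simp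
    rw [h1, h2, ← Matrix.det_mul_row, ← Matrix.det_mul_column]
    congr 1
    ext1 i k
    have h3 : reflTheta (2 * (k : ℕ) + 1) = -((oddTheta m k).comp (-X)) := by
      rw [reflTheta, oddTheta, Odd.neg_one_pow ⟨k, rfl⟩]
      ring
    simp only [Matrix.of_apply]
    rw [h3, iterate_derivative_neg, iterate_derivative_comp_neg_X]
    ring
  have hmain : (Matrix.of fun i j : Fin m =>
      derivative^[(i : ℕ)] (derivative (oddTheta m j) - oddTheta m j)).det =
      (Matrix.of fun i k : Fin m => derivative^[(i : ℕ)] (reflTheta (2 * (k : ℕ) + 1))).det *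
        U.det := by
    rw [← Matrix.det_mul]
    congr 1
    ext1 i j
    rw [Matrix.of_apply, hdiff, iterate_derivative_sum, Matrix.mul_apply]
    refine Finset.sum_congr rfl fun k _ => ?_
    rw [Matrix.of_apply, hU, Matrix.of_apply]
    split_ifs with hkj
    · rw [mul_comm, iterate_derivative_C_mul, mul_comm]
    · simp
  have hdet : borderedWronskian derivative (oddTheta m) (fun i => (twDeriv 1)^[i] 1) =
      (-1) ^ m * (Matrix.of fun i j : Fin m =>
        derivative^[(i : ℕ)] (derivative (oddTheta m j) - oddTheta m j)).det := by
    rw [borderedWronskian_eq_det_snoc]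
    simp only [hone]
    -- Each row minus its predecessor: the last column consists of ones, so only its top entry
    -- survives and the other rows become derivatives of θ_j' - θ_j.
    set B : Matrix (Fin (m + 1)) (Fin (m + 1)) ℂ[X] := Matrix.of fun i =>
      Fin.cases (motive := fun _ => Fin (m + 1) → ℂ[X]) (Fin.snoc (oddTheta m) 1)
        (fun i => Fin.snoc (fun j => derivative^[(i : ℕ)] (derivative (oddTheta m j) - oddTheta m j))
          0) i with hB
    rw [Matrix.det_eq_of_forall_row_eq_smul_add_pred (B := B) (fun _ => 1), Matrix.det_succ_column B
      (Fin.last m), Finset.sum_eq_single 0]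
    · have : B.submatrix (Fin.succAbove 0) (Fin.last m).succAbove = Matrix.of fun i j : Fin m =>
          derivative^[(i : ℕ)] (derivative (oddTheta m j) - oddTheta m j) := by
        ext1 i j
        simp [hB]
      rw [this]
      simp [hB]
    · intro i _ hi
      obtain ⟨i, rfl⟩ := Fin.exists_succ_eq.2 hi
      simp [hB]
    · simp
    · intro j
      refine Fin.lastCases ?_ (fun j => ?_) j <;> simp [hB]
    · intro i j
      refine Fin.lastCases ?_ (fun j => ?_) j
      · simp [hB]
      · simp [hB]
  refine ⟨(-1) ^ m * ((∏ i : Fin m, (-1) ^ (i : ℕ)) * (-1) ^ m * (-1) ^ m), ?_, ?_⟩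
  · refine mul_ne_zero (by simp) (mul_ne_zero (mul_ne_zero ?_ (by simp)) (by simp))
    exact Finset.prod_ne_zero_iff.2 fun i _ => by simp
  · rw [hdet, hmain, hR, hUdet]
    simp only [map_mul, map_pow, map_prod, map_neg, map_one]
    ring

/-- The bilinear equation satisfied by `τ` and its reflection. -/
theorem symmTau_bilinear (m : ℕ) :
    derivative (derivative (symmTau (m + 1))) * (symmTau (m + 1)).comp (-X)
      - 2 * derivative (symmTau (m + 1)) * derivative ((symmTau (m + 1)).comp (-X))
      + symmTau (m + 1) * derivative (derivative ((symmTau (m + 1)).comp (-X)))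
      + 2 * (symmTau (m + 1) * derivative ((symmTau (m + 1)).comp (-X))
        - derivative (symmTau (m + 1)) * (symmTau (m + 1)).comp (-X)) = 0 := by
  obtain ⟨s, hs, hsm⟩ := exists_bordered_one_eq (m + 1)
  have h := bordered_hirota 1 (oddTheta (m + 1)) (symmTau_ne_zero _) _
    (derivative_derivative_oddTheta m) 1
  have h1 : twDeriv 1 (1 : ℂ[X]) = 1 := by rw [twDeriv_apply]; simp
  rw [h1, h1, hsm, ← symmTau] at h
  simp only [twDeriv_apply, map_one, derivative_mul, derivative_C, derivative_add, zero_mul,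
    zero_add, one_mul] at h
  refine mul_left_cancel₀ (C_ne_zero.2 hs) ?_
  rw [mul_zero]
  linear_combination h

/-- Two steps of expansion along a column turn `W(θ_1, …, θ_{2m+1}, 1)` into `W(θ_1, …, θ_{2m-1})`. -/
theorem exists_symmTauExt_zero_eq (m : ℕ) : ∃ s : ℂ, s ≠ 0 ∧
    symmTauExt (m + 1) 0 = C s * symmTau m := by
  have hit : ∀ i : ℕ, derivative^[i + 1] (1 : ℂ[X]) = 0 := fun i => by
    rw [Function.iterate_succ_apply, derivative_one, iterate_derivative_zero]
  have h1 : symmTauExt (m + 1) 0 = (-1) ^ (m + 1) * (Matrix.of fun i j : Fin (m + 1) =>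
      derivative^[(i : ℕ)] (symmTheta (2 * (j : ℕ)))).det := by
    rw [symmTauExt, borderedWronskian_eq_det_snoc, Matrix.det_succ_column _ (Fin.last (m + 1)),
      Finset.sum_eq_single 0]
    · rw [symmTheta_zero]
      simp only [Fin.val_zero, zero_add, Matrix.of_apply, Fin.snoc_last, Function.iterate_zero, id,
        mul_one, Fin.val_last]
      congr 2
      ext1 i j
      simp [oddTheta, derivative_symmTheta_succ]
    · intro i _ hi
      obtain ⟨i, rfl⟩ := Fin.exists_succ_eq.2 hi
      simp only [Matrix.of_apply, Fin.snoc_last, Fin.val_succ, symmTheta_zero, hit]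
      simp
    · simp
  have h2 : (Matrix.of fun i j : Fin (m + 1) =>
      derivative^[(i : ℕ)] (symmTheta (2 * (j : ℕ)))).det = symmTau m := by
    rw [Matrix.det_succ_column_zero, Finset.sum_eq_single 0]
    · simp only [Fin.val_zero, Matrix.of_apply, Function.iterate_zero, id, mul_zero,
        symmTheta_zero, pow_zero, one_mul]
      rw [symmTau, polyWronskian]
      congr 1
      ext1 i j
      simp only [Matrix.submatrix_apply, Matrix.of_apply, Fin.zero_succAbove, Fin.val_succ]
      rw [Function.iterate_succ_apply, mul_add, mul_one, derivative_symmTheta_succ, oddTheta]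
    · intro i _ hi
      obtain ⟨i, rfl⟩ := Fin.exists_succ_eq.2 hi
      simp only [Matrix.of_apply, Fin.val_zero, mul_zero, Fin.val_succ, symmTheta_zero, hit]
      simp
    · simp
  refine ⟨(-1) ^ (m + 1), by simp, ?_⟩
  rw [h1, h2]
  simp

/-! ### Leading coefficients of the squared eigenfunction -/

/-- The leading coefficients of the polynomials `∑ τ_i τ_j`, `i + j = N`. -/
noncomputable def sqCoeff (n N : ℕ) : ℂ :=
  ∑ p ∈ Finset.HasAntidiagonal.antidiagonal N, extCoeff n p.1 * extCoeff n p.2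

theorem extCoeff_odd_eq_zero (n j : ℕ) (hj : j < n) : extCoeff n (2 * j + 1) = 0 := by
  rw [extCoeff, symmTauExt_eq_zero n j hj, coeff_zero]

/-- With E = λ d/dλ and n = m + 1, the series y of the `extCoeff` satisfies E²y - (2n+1)Ey = λ²y.
Its square satisfies the third-order symmetric-square equation, whose coefficients give the
recurrence. -/
theorem sqCoeff_recurrence (m N : ℕ) :
    ((N : ℂ) + 2) * ((N : ℂ) + 2 - 4 * (m + 1) - 2) * ((N : ℂ) + 2 - 2 * (m + 1) - 1) *
      sqCoeff (m + 1) (N + 2) = 4 * ((N : ℂ) - 2 * (m + 1)) * sqCoeff (m + 1) N := by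
  set y : PowerSeries ℂ := PowerSeries.mk (extCoeff (m + 1)) with hy
  have hr : ∀ N, PowerSeries.coeff N (y * y) = sqCoeff (m + 1) N := fun N => by
    rw [PowerSeries.coeff_mul, sqCoeff, hy]
    simp only [PowerSeries.coeff_mk]
  set E : PowerSeries ℂ → PowerSeries ℂ := fun f => PowerSeries.X * PowerSeries.derivative ℂ f
    with hE
  have hEc : ∀ f N, PowerSeries.coeff N (E f) = N * PowerSeries.coeff N f := fun f N => by
    rcases N with _ | N
    · simp [hE]
    · rw [hE, PowerSeries.coeff_succ_X_mul, PowerSeries.coeff_derivative]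
      push_cast
      ring
  have hEm : ∀ f g, E (f * g) = E f * g + f * E g := fun f g => by
    simp only [hE, PowerSeries.derivative_mul']
    ring
  have hEa : ∀ f g, E (f + g) = E f + E g := fun f g => by
    simp only [hE, map_add]
    ring
  have hEC : ∀ a : ℂ, E (PowerSeries.C a) = 0 := fun a => by
    simp only [hE, PowerSeries.derivative_C, mul_zero]
  have hEX : E (PowerSeries.X ^ 2) = PowerSeries.C 2 * PowerSeries.X ^ 2 := by
    rw [sq, hEm]
    simp only [hE, PowerSeries.derivative_X, map_ofNat]
    ring
  have hode : E (E y) - PowerSeries.C (2 * ((m : ℂ) + 1) + 1) * E y = PowerSeries.X ^ 2 * y := by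
    ext N
    rw [map_sub, PowerSeries.coeff_C_mul, hEc, hEc, PowerSeries.coeff_X_pow_mul', hy]
    simp only [PowerSeries.coeff_mk]
    rcases N with _ | _ | N
    · simp
    · simp [extCoeff_odd_eq_zero (m + 1) 0 (Nat.succ_pos m)]
    · rw [if_pos (by omega), show N + 1 + 1 - 2 = N by omega, ← extCoeff_recurrence m N]
      push_cast
      ring
  have hode2 : E (E y) = PowerSeries.C (2 * ((m : ℂ) + 1) + 1) * E y + PowerSeries.X ^ 2 * y := by
    linear_combination hode
  have hcube : E (E (E (y * y))) - PowerSeries.C (2 * ((m : ℂ) + 1) + 1) * E (E (y * y))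
      - PowerSeries.C 2 * E (PowerSeries.X ^ 2 * (y * y))
      - PowerSeries.C (2 * (2 * ((m : ℂ) + 1) + 1)) * (E (E (y * y))
        - PowerSeries.C (2 * ((m : ℂ) + 1) + 1) * E (y * y)
        - PowerSeries.C 2 * (PowerSeries.X ^ 2 * (y * y))) =
      PowerSeries.C 2 * (PowerSeries.X ^ 2 * E (y * y)) := by
    simp only [hEm, hEa, hode2, hEC, hEX, map_mul, map_ofNat]
    ring
  have h := congrArg (PowerSeries.coeff (N + 2)) hcube
  simp only [map_sub, PowerSeries.coeff_C_mul, hEc, PowerSeries.coeff_X_pow_mul, hr] at h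
  push_cast at h
  linear_combination h

/-- At N = 2n + 1, with n = m + 1, every term except the two containing index 0 has an odd index
below 2n + 1, where `extCoeff` is zero. From there on the factor N - 2n is odd, hence nonzero, so
nonvanishing propagates. -/
theorem sqCoeff_ne_zero (m i : ℕ) : sqCoeff (m + 1) (2 * (m + 1) + 1 + 2 * i) ≠ 0 := by
  induction i with
  | zero =>
    have h0 : extCoeff (m + 1) 0 ≠ 0 := extCoeff_ne_zero _ _ fun j _ => by omega
    have h1 : extCoeff (m + 1) (2 * (m + 1) + 1) ≠ 0 := extCoeff_ne_zero _ _ fun j _ => by omega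
    have h2 : sqCoeff (m + 1) (2 * (m + 1) + 1) =
        2 * (extCoeff (m + 1) 0 * extCoeff (m + 1) (2 * (m + 1) + 1)) := by
      rw [sqCoeff, ← Finset.sum_subset
        (s₁ := {((0 : ℕ), 2 * (m + 1) + 1), (2 * (m + 1) + 1, 0)}), Finset.sum_pair]
      · ring
      · simp
      · intro p hp
        simp only [Finset.mem_insert, Finset.mem_singleton] at hp
        rcases hp with rfl | rfl <;> simp
      · rintro ⟨p, q⟩ hpq hn
        simp only [Finset.HasAntidiagonal.mem_antidiagonal, Finset.mem_insert,
          Finset.mem_singleton, Prod.mk.injEq] at hpq hn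
        rcases Nat.even_or_odd' p with ⟨r, rfl | rfl⟩
        · have : q = 2 * (m + 1 - r) + 1 := by omega
          subst this
          simp only
          rw [extCoeff_odd_eq_zero _ _ (by omega), mul_zero]
        · simp only
          rw [extCoeff_odd_eq_zero _ _ (by omega), zero_mul]
    rw [mul_zero, add_zero, h2]
    exact mul_ne_zero two_ne_zero (mul_ne_zero h0 h1)
  | succ i ih =>
    intro h
    have hrec := sqCoeff_recurrence m (2 * (m + 1) + 1 + 2 * i)
    rw [show 2 * (m + 1) + 1 + 2 * i + 2 = 2 * (m + 1) + 1 + 2 * (i + 1) by ring, h, mul_zero] at hrec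
    have h3 : ((2 * (m + 1) + 1 + 2 * i : ℕ) : ℂ) - 2 * (m + 1) = ((2 * i + 1 : ℕ) : ℂ) := by
      push_cast; ring
    rw [h3] at hrec
    have h4 : ((2 * i + 1 : ℕ) : ℂ) ≠ 0 := Nat.cast_ne_zero.2 (by omega)
    exact mul_ne_zero (mul_ne_zero (by norm_num) h4) ih hrec.symm

/-! ### Linearized identities for a signed equilibrium -/

section VortexSums

variable {ι : Type*} [Fintype ι] [DecidableEq ι] {x ε ζ : ι → ℂ} {μ : ℂ}

/-- With w_i = 1/(x_i - x_k), symmetrizing ∑ ε_i w_i² F_i, where F_i = ∑_j ε_j/(x_i - x_j) = μ,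
yields the locus equation ∑ (1 + ε_j) w_j³ = 0. The proof carries out the first variation of this
computation with x_k held fixed. -/
theorem linearized_locus_of_center (hx : Function.Injective x) (hε : ∀ i, ε i * ε i = 1)
    (hF : ∀ i, ∑ j, ε j * (x i - x j)⁻¹ = μ)
    (hL : ∀ i, ∑ j, ε j * (ζ i - ζ j) * (x i - x j)⁻¹ ^ 2 = 0) (k : ι) (hk : ε k = 1)
    (hζ : ζ k = 0) : ∑ j, (1 + ε j) * ζ j * (x j - x k)⁻¹ ^ 4 = 0 := by
  set w : ι → ℂ := fun i => (x i - x k)⁻¹ with hw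
  have hwk : w k = 0 := by simp [hw]
  set T : ι → ι → ℂ := fun i j => ε i * ε j * (2 * ζ i * w i ^ 3 * (x i - x j)⁻¹ +
    (ζ i - ζ j) * w i ^ 2 * (x i - x j)⁻¹ ^ 2) with hT
  -- Off the special indices the symmetrized term splits into products. The last three terms correct
  -- for i = j, j = k and i = k, where 0⁻¹ = 0 breaks the generic formula.
  have hsymm : ∀ i j, T i j + T j i =
      (-2 * ((ε i * ζ i * w i ^ 3) * (ε j * w j)) - (ε i * ζ i * w i ^ 2) * (ε j * w j ^ 2)) +
      (-2 * ((ε j * ζ j * w j ^ 3) * (ε i * w i)) - (ε j * ζ j * w j ^ 2) * (ε i * w i ^ 2)) +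
      (if i = j then 6 * (ζ i * w i ^ 4) else 0) +
      (if j = k then 3 * (ε i * ζ i * w i ^ 4) else 0) +
      (if i = k then 3 * (ε j * ζ j * w j ^ 4) else 0) := by
    intro i j
    by_cases hij : i = j
    · subst hij
      have h1 : (if i = k then 3 * (ε i * ζ i * w i ^ 4) else 0) = 0 := by
        split_ifs with h
        · rw [h, hζ]; ring
        · rfl
      rw [h1]
      simp only [hT, if_true, sub_self, inv_zero]
      linear_combination (6 * ζ i * w i ^ 4) * hε i
    · rw [if_neg hij]
      have hxij : x i - x j ≠ 0 := sub_ne_zero.2 fun h => hij (hx h)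
      have hinv : (x j - x i)⁻¹ = -(x i - x j)⁻¹ := by rw [← inv_neg, neg_sub]
      by_cases hjk : j = k
      · subst hjk
        rw [if_pos rfl, if_neg hij]
        simp only [hT, hwk, hζ, hk]
        simp only [hw]
        ring
      · by_cases hik : i = k
        · subst hik
          rw [if_neg hjk, if_pos rfl]
          simp only [hT, hwk, hζ, hk]
          simp only [hw]
          ring
        · rw [if_neg hjk, if_neg hik]
          have h1 : x i - x k ≠ 0 := sub_ne_zero.2 fun h => hik (hx h)
          have h2 : x j - x k ≠ 0 := sub_ne_zero.2 fun h => hjk (hx h)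
          simp only [hT, hw, hinv]
          have h3 : x i - x j = (x i - x k) - (x j - x k) := by ring
          rw [h3] at hxij ⊢
          generalize x i - x k = u at *
          generalize x j - x k = v at *
          field_simp
          ring
  have hsum : ∑ i, ∑ j, T i j = 2 * μ * ∑ i, ε i * ζ i * w i ^ 3 := by
    have h0 : ∀ i, ∑ j, T i j = 2 * μ * (ε i * ζ i * w i ^ 3) := by
      intro i
      have : ∀ j, T i j = (2 * (ε i * ζ i * w i ^ 3)) * (ε j * (x i - x j)⁻¹) +
          (ε i * w i ^ 2) * (ε j * (ζ i - ζ j) * (x i - x j)⁻¹ ^ 2) := fun j => by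
        simp only [hT]; ring
      simp only [this, Finset.sum_add_distrib, ← Finset.mul_sum, hF, hL]
      ring
    simp only [h0, ← Finset.mul_sum]
  have hμ : ∑ j, ε j * w j = -μ := by
    rw [← hF k, ← Finset.sum_neg_distrib]
    refine Finset.sum_congr rfl fun j _ => ?_
    simp only [hw]
    rw [← mul_neg, ← inv_neg, neg_sub]
  have hL0 : ∑ j, ε j * ζ j * w j ^ 2 = 0 := by
    rw [← neg_eq_zero, ← hL k, ← Finset.sum_neg_distrib]
    refine Finset.sum_congr rfl fun j _ => ?_
    simp only [hw, hζ]
    rw [← neg_sub (x k), inv_neg]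
    ring
  have h2 : 2 * ∑ i, ∑ j, T i j = ∑ i, ∑ j, (T i j + T j i) := by
    simp only [Finset.sum_add_distrib]
    rw [Finset.sum_comm (f := fun i j => T j i)]
    ring
  rw [hsum] at h2
  simp only [hsymm, Finset.sum_add_distrib, Finset.sum_sub_distrib, ← Finset.mul_sum,
    ← Finset.sum_mul, hμ, hL0, Finset.sum_ite_eq, Finset.sum_ite_eq', Finset.mem_univ, if_true] at h2
  have h3 : ∑ i, ∑ j, (if i = k then 3 * (ε j * ζ j * w j ^ 4) else 0) =
      3 * ∑ j, ε j * ζ j * w j ^ 4 := by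
    rw [Finset.sum_comm]
    simp [Finset.mul_sum]
  rw [h3] at h2
  have h4 : ∑ j, (1 + ε j) * ζ j * w j ^ 4 = ∑ j, ζ j * w j ^ 4 + ∑ j, ε j * ζ j * w j ^ 4 := by
    rw [← Finset.sum_add_distrib]
    exact Finset.sum_congr rfl fun j _ => by ring
  rw [h4]
  linear_combination (-1 / 6 : ℂ) * h2

/-- A vortex equilibrium solves the locus equations, and so do its infinitesimal deformations. -/
theorem linearized_locus (hx : Function.Injective x) (hε : ∀ i, ε i * ε i = 1)
    (hF : ∀ i, ∑ j, ε j * (x i - x j)⁻¹ = μ)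
    (hL : ∀ i, ∑ j, ε j * (ζ i - ζ j) * (x i - x j)⁻¹ ^ 2 = 0) (k : ι) (hk : ε k = 1) :
    ∑ j, (1 + ε j) * (ζ k - ζ j) * (x k - x j)⁻¹ ^ 4 = 0 := by
  have h := linearized_locus_of_center (ζ := fun i => ζ i - ζ k) hx hε hF (fun i => by
    simpa using hL i) k hk (sub_self _)
  rw [← neg_eq_zero, ← Finset.sum_neg_distrib, ← h]
  refine Finset.sum_congr rfl fun j _ => ?_
  rw [← neg_sub (x k), inv_neg]
  ring

/-- The directional derivative of (x - y) ∑ x^a y^{r-1-a} = x^r - y^r along (ξ, η). -/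
theorem geom_sum₂_deriv (x y ξ η : ℂ) (r : ℕ) :
    (∑ a ∈ Finset.range r, ((a : ℂ) * x ^ (a - 1) * ξ * y ^ (r - 1 - a) +
      x ^ a * (((r - 1 - a : ℕ) : ℂ) * y ^ (r - 1 - a - 1) * η))) * (x - y) +
      (∑ a ∈ Finset.range r, x ^ a * y ^ (r - 1 - a)) * (ξ - η) =
      r * (x ^ (r - 1) * ξ - y ^ (r - 1) * η) := by
  have h := congrArg (fun f => (derivative f).eval 0)
    (geom_sum₂_mul (C x + C ξ * X) (C y + C η * X) r)
  simp only [derivative_mul, derivative_sum, derivative_sub, derivative_pow, derivative_add,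
    derivative_C, derivative_X, eval_add, eval_sub, eval_mul, eval_pow, eval_finsetSum, eval_C,
    eval_X, zero_mul, mul_zero, zero_add, add_zero, mul_one, eval_natCast, map_natCast] at h
  rw [h]
  ring

/-- Pairing the force equations with ε_i x_i^{r+1} and symmetrizing gives ∑_{i≠j} ε_i ε_j h_r(x_i,
x_j) = 2μ ∑ ε_i x_i^{r+1}, with h_r the complete homogeneous polynomial. After linearization the
right side is 2(r+1)μ times the signed moment of order r. The left side involves lower moments only:
signed ones from the full double sum, and unsigned ones from the diagonal removed from it, since
ε_i² = 1. -/
theorem moment_eq_zero_of_lower (hx : Function.Injective x) (hε : ∀ i, ε i * ε i = 1) (hμ : μ ≠ 0)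
    (hF : ∀ i, ∑ j, ε j * (x i - x j)⁻¹ = μ)
    (hL : ∀ i, ∑ j, ε j * (ζ i - ζ j) * (x i - x j)⁻¹ ^ 2 = 0) (r : ℕ)
    (h1 : ∀ s < r, ∑ i, ζ i * x i ^ s = 0) (h2 : ∀ s < r, ∑ i, ε i * ζ i * x i ^ s = 0) :
    ∑ i, ε i * ζ i * x i ^ r = 0 := by
  set G : ι → ι → ℂ := fun i j => ∑ a ∈ Finset.range (r + 1),
    ((a : ℂ) * x i ^ (a - 1) * ζ i * x j ^ (r - a) +
      x i ^ a * (((r - a : ℕ) : ℂ) * x j ^ (r - a - 1) * ζ j)) with hG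
  have hGsum : ∑ i, ∑ j, ε i * ε j * G i j = 0 := by
    have : ∀ i j, ε i * ε j * G i j = ∑ a ∈ Finset.range (r + 1),
        (((a : ℂ) * (ε i * ζ i * x i ^ (a - 1))) * (ε j * x j ^ (r - a)) +
          (((r - a : ℕ) : ℂ) * (ε i * x i ^ a)) * (ε j * ζ j * x j ^ (r - a - 1))) := by
      intro i j
      simp only [hG, Finset.mul_sum]
      exact Finset.sum_congr rfl fun a _ => by ring
    simp only [this]
    have hc : ∀ i, ∑ j, ∑ a ∈ Finset.range (r + 1),
        (((a : ℂ) * (ε i * ζ i * x i ^ (a - 1))) * (ε j * x j ^ (r - a)) +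
          (((r - a : ℕ) : ℂ) * (ε i * x i ^ a)) * (ε j * ζ j * x j ^ (r - a - 1))) =
        ∑ a ∈ Finset.range (r + 1),
          (((a : ℂ) * (ε i * ζ i * x i ^ (a - 1))) * ∑ j, (ε j * x j ^ (r - a))) := by
      intro i
      rw [Finset.sum_comm]
      refine Finset.sum_congr rfl fun a ha => ?_
      rw [Finset.sum_add_distrib, ← Finset.mul_sum, ← Finset.mul_sum]
      rcases Nat.eq_zero_or_pos (r - a) with h0 | h0
      · rw [h0]; simp
      · rw [h2 _ (by omega)]
        simp
    simp only [hc]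
    rw [Finset.sum_comm]
    refine Finset.sum_eq_zero fun a ha => ?_
    rw [← Finset.sum_mul, ← Finset.mul_sum]
    rw [Finset.mem_range] at ha
    rcases Nat.eq_zero_or_pos a with h0 | h0
    · rw [h0]; simp
    · rw [h2 _ (by omega)]
      simp
  have hGdiag : ∑ i, G i i = 0 := by
    have : ∀ i, G i i = ∑ a ∈ Finset.range (r + 1), (r : ℂ) * (ζ i * x i ^ (r - 1)) := by
      intro i
      refine Finset.sum_congr rfl fun a ha => ?_
      rw [Finset.mem_range] at ha
      have e1 : (a : ℂ) * x i ^ (a - 1) * x i ^ (r - a) = a * x i ^ (r - 1) := by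
        rcases a with _ | a
        · simp
        · rw [mul_assoc, ← pow_add, show a + 1 - 1 + (r - (a + 1)) = r - 1 by omega]
      have e2 : x i ^ a * (((r - a : ℕ) : ℂ) * x i ^ (r - a - 1)) =
          ((r - a : ℕ) : ℂ) * x i ^ (r - 1) := by
        rcases Nat.eq_zero_or_pos (r - a) with h0 | h0
        · simp [h0]
        · rw [mul_left_comm, ← pow_add, show a + (r - a - 1) = r - 1 by omega]
      have e3 : ((r - a : ℕ) : ℂ) = r - a := Nat.cast_sub (by omega)
      rw [e3] at e2 ⊢
      linear_combination ζ i * e1 + ζ i * e2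
    simp only [this, Finset.sum_const, Finset.card_range]
    rw [← Finset.smul_sum, ← Finset.mul_sum]
    rcases Nat.eq_zero_or_pos r with h0 | h0
    · rw [h0]; simp
    · rw [h1 _ (by omega)]
      simp
  have hkey : ∀ i j, ε i * ε j * G i j - (if i = j then G i i else 0) =
      ((r : ℂ) + 1) * (ε i * ζ i * x i ^ r * (ε j * (x i - x j)⁻¹)) +
      ((r : ℂ) + 1) * (ε j * ζ j * x j ^ r * (ε i * (x j - x i)⁻¹)) -
      ε i * x i ^ (r + 1) * (ε j * (ζ i - ζ j) * (x i - x j)⁻¹ ^ 2) -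
      ε j * x j ^ (r + 1) * (ε i * (ζ j - ζ i) * (x j - x i)⁻¹ ^ 2) := by
    intro i j
    by_cases hij : i = j
    · subst hij
      simp [hε]
    · rw [if_neg hij, sub_zero]
      have hd : x i - x j ≠ 0 := sub_ne_zero.2 fun h => hij (hx h)
      have g1 := geom_sum₂_deriv (x i) (x j) (ζ i) (ζ j) (r + 1)
      have g2 := geom_sum₂_mul (x i) (x j) (r + 1)
      simp only [Nat.add_sub_cancel] at g1 g2
      have hinv : (x j - x i)⁻¹ = -(x i - x j)⁻¹ := by rw [← inv_neg, neg_sub]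
      have hG' : G i j = ((r : ℂ) + 1) * (x i ^ r * ζ i - x j ^ r * ζ j) * (x i - x j)⁻¹ -
          (x i ^ (r + 1) - x j ^ (r + 1)) * (ζ i - ζ j) * (x i - x j)⁻¹ ^ 2 := by
        rw [← g2]
        push_cast at g1
        have g3 : G i j * (x i - x j) + (∑ c ∈ Finset.range (r + 1), x i ^ c * x j ^ (r - c)) *
          (ζ i - ζ j) = (r + 1) * (x i ^ r * ζ i - x j ^ r * ζ j) := g1
        rw [← g3]
        field_simp
        ring
      rw [hG', hinv]
      ring
  have hall : ∑ i, ∑ j, (ε i * ε j * G i j - (if i = j then G i i else 0)) = 0 := by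
    simp only [Finset.sum_sub_distrib, Finset.sum_ite_eq, Finset.mem_univ, if_true, hGsum, hGdiag,
      sub_zero]
  simp only [hkey, Finset.sum_sub_distrib, Finset.sum_add_distrib] at hall
  rw [Finset.sum_comm (f := fun i j => ((r : ℂ) + 1) * (ε j * ζ j * x j ^ r * (ε i * (x j - x i)⁻¹))),
    Finset.sum_comm (f := fun i j => ε j * x j ^ (r + 1) * (ε i * (ζ j - ζ i) * (x j - x i)⁻¹ ^ 2))]
    at hall
  simp only [← Finset.mul_sum, hF, hL, mul_zero, Finset.sum_const_zero, sub_zero] at hall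
  rw [← Finset.sum_mul] at hall
  have hr : ((r : ℂ) + 1) ≠ 0 := Nat.cast_add_one_ne_zero r
  have : (2 * ((r : ℂ) + 1) * μ) * ∑ i, ε i * ζ i * x i ^ r = 0 := by linear_combination hall
  exact (mul_eq_zero.1 this).resolve_left (mul_ne_zero (mul_ne_zero two_ne_zero hr) hμ)

end VortexSums

/-! ### The derivative of the force map -/

section VortexForce

variable {N : ℕ} {a b : Fin N → ℂ}

theorem differentiableAt_vortexForce (ha : Function.Injective a) (hb : Function.Injective b)
    (hab : ∀ i j, a i ≠ b j) : DifferentiableAt ℂ (vortexForce N) (a, b) := by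
  have h1 : ∀ k : Fin N, DifferentiableAt ℂ (fun x : (Fin N → ℂ) × (Fin N → ℂ) => x.1 k) (a, b) :=
    fun k => by fun_prop
  have h2 : ∀ k : Fin N, DifferentiableAt ℂ (fun x : (Fin N → ℂ) × (Fin N → ℂ) => x.2 k) (a, b) :=
    fun k => by fun_prop
  unfold vortexForce
  simp only [one_div]
  refine DifferentiableAt.prodMk (differentiableAt_pi.2 fun k => ?_)
    (differentiableAt_pi.2 fun k => ?_)
  · refine DifferentiableAt.fun_sub (DifferentiableAt.fun_sum fun j hj => ?_)
      (DifferentiableAt.fun_sum fun j _ => ?_)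
    · exact DifferentiableAt.fun_inv ((h1 k).fun_sub (h1 j))
        (sub_ne_zero.2 fun h => (Finset.ne_of_mem_erase hj) (ha h).symm)
    · exact DifferentiableAt.fun_inv ((h1 k).fun_sub (h2 j)) (sub_ne_zero.2 (hab k j))
  · refine DifferentiableAt.fun_sub (DifferentiableAt.fun_sum fun j hj => ?_)
      (DifferentiableAt.fun_sum fun j _ => ?_)
    · exact DifferentiableAt.fun_inv ((h2 k).fun_sub (h2 j))
        (sub_ne_zero.2 fun h => (Finset.ne_of_mem_erase hj) (hb h).symm)
    · exact DifferentiableAt.fun_inv ((h2 k).fun_sub (h1 j)) (sub_ne_zero.2 (hab j k).symm)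

theorem hasDerivAt_one_div_sub {p q ξ η : ℂ} (h : p ≠ q) :
    HasDerivAt (fun t : ℂ => 1 / ((p + t * ξ) - (q + t * η))) (-((ξ - η) * (p - q)⁻¹ ^ 2)) 0 := by
  have h1 : ∀ u v : ℂ, HasDerivAt (fun t : ℂ => u + t * v) v 0 := fun u v => by
    simpa using ((hasDerivAt_id (0 : ℂ)).mul_const v).const_add u
  have h2 := ((h1 p ξ).fun_sub (h1 q η)).fun_inv (by simpa using sub_ne_zero.2 h)
  simp only [one_div]
  refine h2.congr_deriv ?_
  simp only [zero_mul, add_zero]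
  rw [inv_pow, div_eq_mul_inv]
  ring

theorem linearized_forces_eq_zero (ha : Function.Injective a) (hb : Function.Injective b)
    (hab : ∀ i j, a i ≠ b j) {ξ η : Fin N → ℂ}
    (h : fderiv ℂ (vortexForce N) (a, b) (ξ, η) = 0) (i : Fin N ⊕ Fin N) :
    ∑ j, (Sum.elim (fun _ => 1) (fun _ => -1) : Fin N ⊕ Fin N → ℂ) j *
      (Sum.elim ξ η i - Sum.elim ξ η j) * (Sum.elim a b i - Sum.elim a b j)⁻¹ ^ 2 = 0 := by
  have hd := (differentiableAt_vortexForce ha hb hab).hasFDerivAt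
  have hline : HasDerivAt (fun t : ℂ => ((a, b) + t • (ξ, η) : (Fin N → ℂ) × (Fin N → ℂ))) (ξ, η) 0 := by
    simpa using ((hasDerivAt_id (0 : ℂ)).fun_smul
      (hasDerivAt_const (0 : ℂ) ((ξ, η) : (Fin N → ℂ) × (Fin N → ℂ)))).const_add (a, b)
  have hcomp : HasDerivAt (fun t : ℂ => vortexForce N ((a, b) + t • (ξ, η))) 0 0 := by
    rw [← h]
    have hd' : HasFDerivAt (vortexForce N) (fderiv ℂ (vortexForce N) (a, b))
        ((fun t : ℂ => ((a, b) + t • (ξ, η) : (Fin N → ℂ) × (Fin N → ℂ))) 0) := by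
      simpa using hd
    exact hd'.comp_hasDerivAt (0 : ℂ) hline
  have hfst := hasDerivAt_pi.1 hcomp.fst
  have hsnd := hasDerivAt_pi.1 hcomp.snd
  rcases i with k | k
  · have h2 : HasDerivAt (fun t : ℂ => (vortexForce N ((a, b) + t • (ξ, η))).1 k)
        (∑ j ∈ Finset.univ.erase k, -((ξ k - ξ j) * (a k - a j)⁻¹ ^ 2) -
          ∑ j, -((ξ k - η j) * (a k - b j)⁻¹ ^ 2)) 0 := by
      simp only [vortexForce]
      refine HasDerivAt.fun_sub (HasDerivAt.fun_sum fun j hj => ?_)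
        (HasDerivAt.fun_sum fun j _ => ?_)
      · exact hasDerivAt_one_div_sub fun h => (Finset.ne_of_mem_erase hj) (ha h).symm
      · exact hasDerivAt_one_div_sub (hab k j)
    have h3 := (hfst k).unique h2
    rw [Finset.sum_erase _ (by simp)] at h3
    rw [Fintype.sum_sum_type]
    simp only [Finset.sum_neg_distrib] at h3
    simp only [Sum.elim_inl, Sum.elim_inr, one_mul, neg_mul, Finset.sum_neg_distrib]
    have h4 : (0 : ℂ) = _ := h3
    linear_combination h4
  · have h2 : HasDerivAt (fun t : ℂ => (vortexForce N ((a, b) + t • (ξ, η))).2 k)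
        (∑ j ∈ Finset.univ.erase k, -((η k - η j) * (b k - b j)⁻¹ ^ 2) -
          ∑ j, -((η k - ξ j) * (b k - a j)⁻¹ ^ 2)) 0 := by
      simp only [vortexForce]
      refine HasDerivAt.fun_sub (HasDerivAt.fun_sum fun j hj => ?_)
        (HasDerivAt.fun_sum fun j _ => ?_)
      · exact hasDerivAt_one_div_sub fun h => (Finset.ne_of_mem_erase hj) (hb h).symm
      · exact hasDerivAt_one_div_sub (hab j k).symm
    have h3 := (hsnd k).unique h2
    rw [Finset.sum_erase _ (by simp)] at h3
    rw [Fintype.sum_sum_type]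
    simp only [Finset.sum_neg_distrib] at h3
    simp only [Sum.elim_inl, Sum.elim_inr, one_mul, neg_mul, Finset.sum_neg_distrib]
    have h4 : (0 : ℂ) = _ := h3
    linear_combination (-1 : ℂ) * h4

end VortexForce

/-! ### Local expansions of eigenfunctions at a double pole of the potential -/

section LocalExpansion

theorem PowerSeries.coeff_zero_mul' (f g : PowerSeries ℂ) : PowerSeries.coeff 0 (f * g) =
    PowerSeries.coeff 0 f * PowerSeries.coeff 0 g := by
  simp

theorem PowerSeries.coeff_two_mul (f g : PowerSeries ℂ) : PowerSeries.coeff 2 (f * g) =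
    PowerSeries.coeff 0 f * PowerSeries.coeff 2 g + PowerSeries.coeff 1 f * PowerSeries.coeff 1 g +
      PowerSeries.coeff 2 f * PowerSeries.coeff 0 g := by
  rw [PowerSeries.coeff_mul, Finset.Nat.sum_antidiagonal_eq_sum_range_succ_mk]
  simp [Finset.sum_range_succ]

theorem PowerSeries.coeff_one_mul' (f g : PowerSeries ℂ) : PowerSeries.coeff 1 (f * g) =
    PowerSeries.coeff 0 f * PowerSeries.coeff 1 g +
      PowerSeries.coeff 1 f * PowerSeries.coeff 0 g := by
  rw [PowerSeries.coeff_mul, Finset.Nat.sum_antidiagonal_eq_sum_range_succ_mk]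
  simp [Finset.sum_range_succ]

theorem PowerSeries.coeff_four_mul (f g : PowerSeries ℂ) : PowerSeries.coeff 4 (f * g) =
    PowerSeries.coeff 0 f * PowerSeries.coeff 4 g + PowerSeries.coeff 1 f * PowerSeries.coeff 3 g +
      PowerSeries.coeff 2 f * PowerSeries.coeff 2 g + PowerSeries.coeff 3 f * PowerSeries.coeff 1 g +
      PowerSeries.coeff 4 f * PowerSeries.coeff 0 g := by
  rw [PowerSeries.coeff_mul, Finset.Nat.sum_antidiagonal_eq_sum_range_succ_mk]
  simp [Finset.sum_range_succ]

theorem X_add_C_mul_inv {d : ℂ} (hd : d ≠ 0) :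
    (PowerSeries.X + PowerSeries.C d) * (PowerSeries.X + PowerSeries.C d)⁻¹ = 1 :=
  PowerSeries.mul_inv_cancel _ (by simpa using hd)

theorem coeff_two_inv_sq {d : ℂ} (hd : d ≠ 0) :
    PowerSeries.coeff 2 ((PowerSeries.X + PowerSeries.C d)⁻¹ ^ 2) = 3 * d⁻¹ ^ 4 := by
  set w := (PowerSeries.X + PowerSeries.C d)⁻¹ with hw
  have h : PowerSeries.X * w + PowerSeries.C d * w = 1 := by rw [← add_mul]; exact X_add_C_mul_inv hd
  have h0 := congrArg (PowerSeries.coeff 0) h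
  have h1 := congrArg (PowerSeries.coeff 1) h
  have h2 := congrArg (PowerSeries.coeff 2) h
  simp only [map_add, PowerSeries.coeff_C_mul] at h0 h1 h2
  rw [show (2 : ℕ) = 1 + 1 from rfl, PowerSeries.coeff_succ_X_mul, PowerSeries.coeff_one] at h2
  rw [show (1 : ℕ) = 0 + 1 from rfl, PowerSeries.coeff_succ_X_mul, PowerSeries.coeff_one] at h1
  simp only [PowerSeries.coeff_zero_X_mul, PowerSeries.coeff_zero_one, zero_add, one_add_one_eq_two,
    OfNat.ofNat_ne_zero, one_ne_zero, if_false] at h0 h1 h2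
  have e0 : PowerSeries.coeff 0 w = d⁻¹ := by field_simp; linear_combination h0
  have e1 : PowerSeries.coeff 1 w = -d⁻¹ ^ 2 := by
    rw [e0] at h1
    field_simp at h1 ⊢
    linear_combination h1
  have e2 : PowerSeries.coeff 2 w = d⁻¹ ^ 3 := by
    rw [e1] at h2
    field_simp at h2 ⊢
    linear_combination h2
  rw [sq, PowerSeries.coeff_two_mul, e0, e1, e2]
  ring

theorem derivative_prod_X_add_C {ι : Type*} (s : Finset ι) (d : ι → ℂ)
    (hd : ∀ j ∈ s, d j ≠ 0) :
    PowerSeries.derivative ℂ (∏ j ∈ s, (PowerSeries.X + PowerSeries.C (d j))) =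
      (∏ j ∈ s, (PowerSeries.X + PowerSeries.C (d j))) *
        ∑ j ∈ s, (PowerSeries.X + PowerSeries.C (d j))⁻¹ := by
  classical
  induction s using Finset.induction_on with
  | empty => simp
  | insert a s ha ih =>
    have h1 := X_add_C_mul_inv (hd a (Finset.mem_insert_self a s))
    rw [Finset.prod_insert ha, Finset.sum_insert ha, PowerSeries.derivative_mul',
      ih fun j hj => hd j (Finset.mem_insert_of_mem hj)]
    simp only [map_add, PowerSeries.derivative_X, PowerSeries.derivative_C]
    linear_combination (-∏ j ∈ s, (PowerSeries.X + PowerSeries.C (d j))) * h1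

/-- If every `V k / x` solves `Y'' + (-2/x² + U) Y = Y_prev`, then in `V²` the coefficient of `x⁴`
is a multiple of the constant one that does not depend on the spectral parameter. -/
theorem coeff_sum_mul_of_ode (V : ℕ → PowerSeries ℂ) (U : PowerSeries ℂ)
    (h : ∀ k, PowerSeries.X * PowerSeries.derivative ℂ (PowerSeries.derivative ℂ (V k))
      - 2 * PowerSeries.derivative ℂ (V k) + PowerSeries.X * (U * V k) =
      PowerSeries.X * (if 2 ≤ k then V (k - 2) else 0)) (N : ℕ) :
    PowerSeries.coeff 1 (∑ p ∈ Finset.HasAntidiagonal.antidiagonal N, V p.1 * V p.2) = 0 ∧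
    2 * PowerSeries.coeff 4 (∑ p ∈ Finset.HasAntidiagonal.antidiagonal N, V p.1 * V p.2) =
      -PowerSeries.coeff 2 U *
        PowerSeries.coeff 0 (∑ p ∈ Finset.HasAntidiagonal.antidiagonal N, V p.1 * V p.2) := by
  -- The roles are exchanged: v i is the series in the spectral parameter λ formed by the
  -- coefficients of x^i, and passing to V (k - 2) becomes multiplication by λ².
  set v : ℕ → PowerSeries ℂ := fun i => PowerSeries.mk fun k => PowerSeries.coeff i (V k) with hv
  have hvv : ∀ i j, PowerSeries.coeff N (v i * v j) =
      ∑ p ∈ Finset.HasAntidiagonal.antidiagonal N,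
        PowerSeries.coeff i (V p.1) * PowerSeries.coeff j (V p.2) := fun i j => by
    rw [PowerSeries.coeff_mul]
    simp only [hv, PowerSeries.coeff_mk]
  have hprev : ∀ i k, PowerSeries.coeff i (if 2 ≤ k then V (k - 2) else 0) =
      PowerSeries.coeff k (PowerSeries.X ^ 2 * v i) := fun i k => by
    rw [PowerSeries.coeff_X_pow_mul']
    split_ifs <;> simp [hv]
  have h2C : (2 : PowerSeries ℂ) = PowerSeries.C 2 := by rw [map_ofNat]
  have hv1 : v 1 = 0 := by
    ext k
    have := congrArg (PowerSeries.coeff 0) (h k)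
    rw [h2C, map_add, map_sub, PowerSeries.coeff_C_mul, PowerSeries.coeff_derivative] at this
    simp only [PowerSeries.coeff_zero_X_mul] at this
    simp only [hv, PowerSeries.coeff_mk, map_zero]
    simpa using this
  have hv2 : PowerSeries.X ^ 2 * v 0 = PowerSeries.C (PowerSeries.coeff 0 U) * v 0 -
      PowerSeries.C 2 * v 2 := by
    ext k
    have := congrArg (PowerSeries.coeff (0 + 1)) (h k)
    rw [h2C, map_add, map_sub, PowerSeries.coeff_C_mul, PowerSeries.coeff_derivative,
      PowerSeries.coeff_succ_X_mul, PowerSeries.coeff_succ_X_mul, PowerSeries.coeff_succ_X_mul,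
      PowerSeries.coeff_derivative, PowerSeries.coeff_derivative, PowerSeries.coeff_zero_mul',
      hprev] at this
    rw [← this, map_sub, PowerSeries.coeff_C_mul, PowerSeries.coeff_C_mul]
    simp only [hv, PowerSeries.coeff_mk]
    push_cast
    simp only [zero_add, one_add_one_eq_two]
    ring
  have hv4 : PowerSeries.X ^ 2 * v 2 = PowerSeries.C 4 * v 4 +
      PowerSeries.C (PowerSeries.coeff 0 U) * v 2 + PowerSeries.C (PowerSeries.coeff 2 U) * v 0 := by
    ext k
    have := congrArg (PowerSeries.coeff (2 + 1)) (h k)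
    rw [h2C, map_add, map_sub, PowerSeries.coeff_C_mul, PowerSeries.coeff_derivative,
      PowerSeries.coeff_succ_X_mul, PowerSeries.coeff_succ_X_mul, PowerSeries.coeff_succ_X_mul,
      PowerSeries.coeff_derivative, PowerSeries.coeff_derivative, PowerSeries.coeff_two_mul,
      hprev] at this
    have h1 : PowerSeries.coeff 1 (V k) = 0 := by
      simpa [hv] using congrArg (PowerSeries.coeff k) hv1
    rw [← this, map_add, map_add, PowerSeries.coeff_C_mul, PowerSeries.coeff_C_mul,
      PowerSeries.coeff_C_mul, h1]
    simp only [hv, PowerSeries.coeff_mk]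
    push_cast
    norm_num
    ring
  -- Eliminating λ² between `hv2` and `hv4` also eliminates the constant coefficient of U.
  have hsq : PowerSeries.C 2 * (PowerSeries.C 2 * (v 0 * v 4) + v 2 * v 2) =
      PowerSeries.C (-PowerSeries.coeff 2 U) * (v 0 * v 0) := by
    have e2 : (PowerSeries.C 2 : PowerSeries ℂ) * PowerSeries.C 2 = PowerSeries.C 4 := by
      rw [← map_mul]; norm_num
    rw [map_neg]
    linear_combination (-v 0) * hv4 + v 2 * hv2 + (v 0 * v 4) * e2
  constructor
  · simp only [map_sum, PowerSeries.coeff_one_mul', Finset.sum_add_distrib, ← hvv, hv1]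
    simp
  · have := congrArg (PowerSeries.coeff N) hsq
    simp only [map_add, PowerSeries.coeff_C_mul, hvv] at this
    simp only [map_sum, PowerSeries.coeff_four_mul, PowerSeries.coeff_zero_mul',
      Finset.sum_add_distrib, ← hvv, hv1, mul_comm (v 4)]
    simp only [← hvv] at this
    rw [← this]
    simp
    ring

end LocalExpansion

/-! ### Partial fractions at simple roots -/

section Decomposition

variable {N : ℕ} (a : Fin N → ℂ) (l : ℂ)

/-- `l ∏_{j ≠ k} (X - a_j)`. -/
noncomputable def deletedProd (k : Fin N) : ℂ[X] :=
  C l * ∏ j ∈ Finset.univ.erase k, (X - C (a j))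

theorem X_sub_C_mul_deletedProd (k : Fin N) :
    (X - C (a k)) * deletedProd a l k = C l * ∏ j, (X - C (a j)) := by
  rw [deletedProd, ← Finset.mul_prod_erase Finset.univ _ (Finset.mem_univ k)]
  ring

theorem taylorPS_X_sub_C (p q : ℂ) :
    taylorPS p (X - C q) = PowerSeries.X + PowerSeries.C (p - q) := by
  rw [taylorPS_apply, map_sub, taylor_X, taylor_C]
  push_cast
  rw [map_sub]
  ring

theorem taylorPS_C (p q : ℂ) : taylorPS p (C q) = PowerSeries.C q := by
  rw [taylorPS_apply, taylor_C, Polynomial.coe_C]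

variable {a l}

theorem taylorPS_deletedProd (k : Fin N) : taylorPS (a k) (deletedProd a l k) =
    PowerSeries.C l * ∏ j ∈ Finset.univ.erase k, (PowerSeries.X + PowerSeries.C (a k - a j)) := by
  rw [deletedProd, map_mul, map_prod, taylorPS_C]
  simp only [taylorPS_X_sub_C]

theorem taylorPS_deletedProd_ne (ha : Function.Injective a) {k j : Fin N} (h : j ≠ k) :
    taylorPS (a k) (deletedProd a l j) = PowerSeries.X *
      (PowerSeries.X + PowerSeries.C (a k - a j))⁻¹ * taylorPS (a k) (deletedProd a l k) := by
  have h1 := congrArg (taylorPS (a k)) ((X_sub_C_mul_deletedProd a l j).trans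
    (X_sub_C_mul_deletedProd a l k).symm)
  rw [map_mul, map_mul, taylorPS_X_sub_C, taylorPS_X_sub_C, sub_self, map_zero, add_zero] at h1
  have h2 := X_add_C_mul_inv (d := a k - a j) (sub_ne_zero.2 fun e => h (ha e).symm)
  linear_combination (PowerSeries.X + PowerSeries.C (a k - a j))⁻¹ * h1 -
    taylorPS (a k) (deletedProd a l j) * h2

theorem eval_deletedProd_ne_zero (ha : Function.Injective a) (hl : l ≠ 0) (k : Fin N) :
    (deletedProd a l k).eval (a k) ≠ 0 := by
  rw [deletedProd, eval_mul, eval_C, eval_prod]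
  refine mul_ne_zero hl (Finset.prod_ne_zero_iff.2 fun j hj => ?_)
  rw [eval_sub, eval_X, eval_C]
  exact sub_ne_zero.2 fun e => (Finset.ne_of_mem_erase hj) (ha e).symm

/-- The local form of a Hirota-type equation at a simple root of `P`. -/
theorem local_ode_of_hirota (ha : Function.Injective a) (hl : l ≠ 0) (k : Fin N) {P T S : ℂ[X]}
    (hP : P = C l * ∏ j, (X - C (a j)))
    (h : P * derivative (derivative T) - 2 * derivative P * derivative T +
      derivative (derivative P) * T = P * S) (u' : PowerSeries ℂ)
    (hu : u' = (taylorPS (a k) (deletedProd a l k))⁻¹) :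
    PowerSeries.X * PowerSeries.derivative ℂ (PowerSeries.derivative ℂ (taylorPS (a k) T * u'))
      - 2 * PowerSeries.derivative ℂ (taylorPS (a k) T * u')
      + PowerSeries.X * ((PowerSeries.C (-2) * ∑ j ∈ Finset.univ.erase k,
        (PowerSeries.X + PowerSeries.C (a k - a j))⁻¹ ^ 2) * (taylorPS (a k) T * u')) =
      PowerSeries.X * (taylorPS (a k) S * u') := by
  set u := taylorPS (a k) (deletedProd a l k) with hu'
  have hu0 : PowerSeries.constantCoeff u ≠ 0 := by
    rw [hu', constantCoeff_taylorPS]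
    exact eval_deletedProd_ne_zero ha hl k
  have hune : u ≠ 0 := fun h0 => hu0 (by rw [h0, map_zero])
  have huu : u * u' = 1 := by rw [hu]; exact PowerSeries.mul_inv_cancel _ hu0
  -- Here P = xu in the local coordinate x and s is the logarithmic derivative of u. The potential
  -- 2(log P)'' is therefore -2/x² plus twice the derivative of s, whose regular part is the sum in
  -- the statement.
  set s := ∑ j ∈ Finset.univ.erase k, (PowerSeries.X + PowerSeries.C (a k - a j))⁻¹ with hs
  have hd1 : PowerSeries.derivative ℂ u = u * s := by
    rw [hu', taylorPS_deletedProd, PowerSeries.derivative_mul', PowerSeries.derivative_C,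
      derivative_prod_X_add_C _ _ fun j hj => sub_ne_zero.2 fun e =>
        (Finset.ne_of_mem_erase hj) (ha e).symm, hs]
    ring
  have hds : PowerSeries.derivative ℂ s = -∑ j ∈ Finset.univ.erase k,
      (PowerSeries.X + PowerSeries.C (a k - a j))⁻¹ ^ 2 := by
    rw [hs, map_sum, ← Finset.sum_neg_distrib]
    refine Finset.sum_congr rfl fun j _ => ?_
    rw [PowerSeries.derivative_inv', map_add, PowerSeries.derivative_X, PowerSeries.derivative_C]
    ring
  set V := taylorPS (a k) T * u' with hV
  have hT : taylorPS (a k) T = u * V := by rw [hV]; linear_combination (-taylorPS (a k) T) * huu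
  have hPu : taylorPS (a k) P = PowerSeries.X * u := by
    rw [hP, ← X_sub_C_mul_deletedProd a l k, map_mul, taylorPS_X_sub_C, sub_self, map_zero,
      add_zero]
  have h1 := congrArg (taylorPS (a k)) h
  simp only [map_add, map_sub, map_mul, taylorPS_derivative, map_ofNat, hPu, hT,
    PowerSeries.derivative_mul', PowerSeries.derivative_X, hd1, one_mul] at h1
  refine mul_left_cancel₀ (mul_ne_zero hune hune) ?_
  have h2 : PowerSeries.C (-2 : ℂ) = (-2 : PowerSeries ℂ) := by rw [map_neg, map_ofNat]
  have h3 : ∑ j ∈ Finset.univ.erase k, (PowerSeries.X + PowerSeries.C (a k - a j))⁻¹ ^ 2 =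
      -PowerSeries.derivative ℂ s := by rw [hds, neg_neg]
  rw [h2, h3]
  linear_combination h1 - (PowerSeries.X * u * taylorPS (a k) S) * huu

/-- Partial fractions of `g / P²` when all residues vanish. -/
theorem exists_decomposition (ha : Function.Injective a) (hl : l ≠ 0) (g : ℂ[X])
    (hg : ∀ k, PowerSeries.coeff 1
      (taylorPS (a k) g * (taylorPS (a k) (deletedProd a l k))⁻¹ ^ 2) = 0) :
    ∃ (Q : ℂ[X]) (A : Fin N → ℂ),
      g = (C l * ∏ j, (X - C (a j))) ^ 2 * Q + ∑ j, C (A j) * deletedProd a l j ^ 2 ∧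
      ∀ k, taylorPS (a k) g * (taylorPS (a k) (deletedProd a l k))⁻¹ ^ 2 =
        PowerSeries.X ^ 2 * taylorPS (a k) Q + PowerSeries.C (A k) +
        PowerSeries.X ^ 2 * ∑ j ∈ Finset.univ.erase k,
          PowerSeries.C (A j) * (PowerSeries.X + PowerSeries.C (a k - a j))⁻¹ ^ 2 := by
  set A : Fin N → ℂ := fun k => PowerSeries.coeff 0
    (taylorPS (a k) g * (taylorPS (a k) (deletedProd a l k))⁻¹ ^ 2) with hA
  have huu : ∀ k, taylorPS (a k) (deletedProd a l k) * (taylorPS (a k) (deletedProd a l k))⁻¹ = 1 :=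
    fun k => PowerSeries.mul_inv_cancel _ (by
      rw [constantCoeff_taylorPS]; exact eval_deletedProd_ne_zero ha hl k)
  have hsum : ∀ k, taylorPS (a k) (∑ j, C (A j) * deletedProd a l j ^ 2) =
      taylorPS (a k) (deletedProd a l k) ^ 2 * (PowerSeries.C (A k) +
        PowerSeries.X ^ 2 * ∑ j ∈ Finset.univ.erase k,
          PowerSeries.C (A j) * (PowerSeries.X + PowerSeries.C (a k - a j))⁻¹ ^ 2) := by
    intro k
    rw [← Finset.add_sum_erase Finset.univ _ (Finset.mem_univ k), map_add, map_sum, mul_add,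
      Finset.mul_sum, Finset.mul_sum]
    congr 1
    · rw [map_mul, map_pow, taylorPS_C]; ring
    · refine Finset.sum_congr rfl fun j hj => ?_
      rw [map_mul, map_pow, taylorPS_C, taylorPS_deletedProd_ne ha (Finset.ne_of_mem_erase hj)]
      ring
  have hdvd : ∀ k, (X - C (a k)) ^ 2 ∣ g - ∑ j, C (A j) * deletedProd a l j ^ 2 := by
    intro k
    rw [X_sub_C_pow_dvd_iff, ← taylor_apply, X_pow_dvd_iff]
    -- The vanishing coefficient of X means g/P² has no residue at a_k, so subtracting the constant
    -- A_k leaves a double zero.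
    obtain ⟨R, hR⟩ : PowerSeries.X ^ 2 ∣
        taylorPS (a k) g * (taylorPS (a k) (deletedProd a l k))⁻¹ ^ 2 - PowerSeries.C (A k) := by
      rw [PowerSeries.X_pow_dvd_iff]
      intro i hi
      interval_cases i
      · rw [map_sub, PowerSeries.coeff_zero_C, hA, sub_self]
      · rw [map_sub, hg, PowerSeries.coeff_C]
        simp
    have h1 : PowerSeries.X ^ 2 ∣ taylorPS (a k) (g - ∑ j, C (A j) * deletedProd a l j ^ 2) := by
      refine ⟨taylorPS (a k) (deletedProd a l k) ^ 2 * (R - ∑ j ∈ Finset.univ.erase k,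
          PowerSeries.C (A j) * (PowerSeries.X + PowerSeries.C (a k - a j))⁻¹ ^ 2), ?_⟩
      have h2 : taylorPS (a k) (deletedProd a l k) ^ 2 *
          (taylorPS (a k) (deletedProd a l k))⁻¹ ^ 2 = 1 := by rw [← mul_pow, huu, one_pow]
      rw [map_sub, hsum]
      linear_combination taylorPS (a k) (deletedProd a l k) ^ 2 * hR - taylorPS (a k) g * h2
    intro d hd
    have := PowerSeries.X_pow_dvd_iff.1 h1 d hd
    rwa [taylorPS_apply, Polynomial.coeff_coe] at this
  have hprod : (∏ j, (X - C (a j)) ^ 2) ∣ g - ∑ j, C (A j) * deletedProd a l j ^ 2 :=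
    Finset.prod_dvd_of_coprime (fun i _ j _ hij =>
      ((pairwise_coprime_X_sub_C ha) hij).pow) fun j _ => hdvd j
  obtain ⟨Q, hQ⟩ := hprod
  have hgQ : g = (C l * ∏ j, (X - C (a j))) ^ 2 * (C (l⁻¹ ^ 2) * Q) +
      ∑ j, C (A j) * deletedProd a l j ^ 2 := by
    rw [sub_eq_iff_eq_add] at hQ
    have h1 : C l ^ 2 * C (l⁻¹ ^ 2) = (1 : ℂ[X]) := by
      rw [← C_pow, ← C_mul, ← mul_pow, mul_inv_cancel₀ hl, one_pow, C_1]
    rw [Finset.prod_pow] at hQ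
    linear_combination hQ - (∏ j, (X - C (a j))) ^ 2 * Q * h1
  refine ⟨C (l⁻¹ ^ 2) * Q, A, hgQ, fun k => ?_⟩
  have h1 := congrArg (taylorPS (a k)) hgQ
  rw [map_add, hsum, map_mul _ (_ ^ 2), ← X_sub_C_mul_deletedProd a l k, map_pow, map_mul,
    taylorPS_X_sub_C, sub_self, map_zero, add_zero] at h1
  have h2 : taylorPS (a k) (deletedProd a l k) ^ 2 *
      (taylorPS (a k) (deletedProd a l k))⁻¹ ^ 2 = 1 := by rw [← mul_pow, huu, one_pow]
  linear_combination (taylorPS (a k) (deletedProd a l k))⁻¹ ^ 2 * h1 +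
    (PowerSeries.X ^ 2 * taylorPS (a k) (C (l⁻¹ ^ 2) * Q) + PowerSeries.C (A k) +
        PowerSeries.X ^ 2 * ∑ j ∈ Finset.univ.erase k,
          PowerSeries.C (A j) * (PowerSeries.X + PowerSeries.C (a k - a j))⁻¹ ^ 2) * h2

end Decomposition

/-! ### Odd moments from the squared eigenfunction -/

section Moments

variable {m N : ℕ} {a : Fin N → ℂ} {l : ℂ}

/-- `∑ τ_i τ_j` over `i + j = K`. -/
noncomputable def symmTauSq (n K : ℕ) : ℂ[X] :=
  ∑ p ∈ Finset.HasAntidiagonal.antidiagonal K, symmTauExt n p.1 * symmTauExt n p.2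

theorem natDegree_symmTauSq_le (n K : ℕ) : (symmTauSq n K).natDegree ≤ 2 * triangle n + K := by
  refine natDegree_sum_le_of_forall_le _ _ fun p hp => natDegree_mul_le.trans ?_
  have h1 := natDegree_symmTauExt_le n p.1
  have h2 := natDegree_symmTauExt_le n p.2
  have h3 := Finset.HasAntidiagonal.mem_antidiagonal.1 hp
  omega

theorem coeff_symmTauSq (n K : ℕ) : (symmTauSq n K).coeff (2 * triangle n + K) = sqCoeff n K := by
  rw [symmTauSq, finsetSum_coeff, sqCoeff]
  refine Finset.sum_congr rfl fun p hp => ?_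
  have h3 := Finset.HasAntidiagonal.mem_antidiagonal.1 hp
  rw [show 2 * triangle n + K = (triangle n + p.1) + (triangle n + p.2) by omega,
    coeff_mul_add_eq_of_natDegree_le (natDegree_symmTauExt_le n p.1) (natDegree_symmTauExt_le n p.2)]
  rfl

theorem natDegree_deletedProd_le (k : Fin N) : (deletedProd a l k).natDegree ≤ N - 1 := by
  refine natDegree_mul_le.trans ?_
  rw [natDegree_C, zero_add, natDegree_prod_of_monic _ _ fun j _ => monic_X_sub_C (a j)]
  simp

/-- The quotient in the partial fraction decomposition is orthogonal to the deformations of the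
locus. -/
theorem sum_mul_hasseDeriv_eq_zero (ha : Function.Injective a) (hl : l ≠ 0)
    (hP : symmTau (m + 1) = C l * ∏ j, (X - C (a j))) {ξ : Fin N → ℂ}
    (hξ : ∀ k, ∑ j, (ξ k - ξ j) * (a k - a j)⁻¹ ^ 4 = 0) (K : ℕ) :
    ∃ (Q : ℂ[X]) (A : Fin N → ℂ),
      symmTauSq (m + 1) K = symmTau (m + 1) ^ 2 * Q + ∑ j, C (A j) * deletedProd a l j ^ 2 ∧
      ∑ k, ξ k * (hasseDeriv 2 Q).eval (a k) = 0 := by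
  set u' : Fin N → PowerSeries ℂ := fun k => (taylorPS (a k) (deletedProd a l k))⁻¹ with hu'
  set V : Fin N → ℕ → PowerSeries ℂ := fun k i => taylorPS (a k) (symmTauExt (m + 1) i) * u' k
    with hV
  have hode : ∀ k, _ := fun k => coeff_sum_mul_of_ode (V k)
    (PowerSeries.C (-2) * ∑ j ∈ Finset.univ.erase k,
        (PowerSeries.X + PowerSeries.C (a k - a j))⁻¹ ^ 2) (fun i => by
      by_cases hi : 2 ≤ i
      · obtain ⟨i, rfl⟩ := Nat.exists_eq_add_of_le' hi
        rw [if_pos hi, Nat.add_sub_cancel]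
        exact local_ode_of_hirota ha hl k hP (symmTauExt_hirota m i) _ rfl
      · have := local_ode_of_hirota ha hl k hP (S := 0)
          ((symmTauExt_hirota_zero m i (not_le.1 hi)).trans (mul_zero _).symm) _ rfl
        rw [map_zero, zero_mul] at this
        rw [if_neg hi]
        exact this) K
  have hVV : ∀ k, ∑ p ∈ Finset.HasAntidiagonal.antidiagonal K, V k p.1 * V k p.2 =
      taylorPS (a k) (symmTauSq (m + 1) K) * u' k ^ 2 := fun k => by
    rw [symmTauSq, map_sum, Finset.sum_mul]
    exact Finset.sum_congr rfl fun p _ => by rw [map_mul]; simp only [hV]; ring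
  simp only [hVV] at hode
  obtain ⟨Q, A, hQ, hloc⟩ := exists_decomposition ha hl (symmTauSq (m + 1) K) fun k => (hode k).1
  rw [← hP] at hQ
  refine ⟨Q, A, hQ, ?_⟩
  have hU : ∀ (B : Fin N → ℂ) (k : Fin N), PowerSeries.coeff 2 (∑ j ∈ Finset.univ.erase k,
      PowerSeries.C (B j) * (PowerSeries.X + PowerSeries.C (a k - a j))⁻¹ ^ 2) =
      3 * ∑ j ∈ Finset.univ.erase k, B j * (a k - a j)⁻¹ ^ 4 := by
    intro B k
    rw [map_sum, Finset.mul_sum]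
    refine Finset.sum_congr rfl fun j hj => ?_
    rw [PowerSeries.coeff_C_mul, coeff_two_inv_sq (sub_ne_zero.2 fun e =>
      (Finset.ne_of_mem_erase hj) (ha e).symm)]
    ring
  -- The X⁴ coefficient is computed twice: from the partial fractions, and from the local equation
  -- as -½ · (X² coefficient of the potential) · A_k.
  have hval : ∀ k, (hasseDeriv 2 Q).eval (a k) = 3 * ∑ j, (A k - A j) * (a k - a j)⁻¹ ^ 4 := by
    intro k
    have h := (hode k).2
    have hl := hloc k
    simp only [hu'] at h
    rw [hl, map_add, map_add, map_add, map_add, PowerSeries.coeff_X_pow_mul',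
      PowerSeries.coeff_X_pow_mul', PowerSeries.coeff_X_pow_mul', PowerSeries.coeff_X_pow_mul',
      if_pos (by norm_num), if_pos (by norm_num), if_neg (by norm_num), if_neg (by norm_num),
      show 4 - 2 = 2 from rfl, hU, PowerSeries.coeff_C, PowerSeries.coeff_C,
      PowerSeries.coeff_C_mul] at h
    have h1 := hU (fun _ => 1) k
    simp only [map_one, one_mul] at h1
    rw [h1, taylorPS_apply, Polynomial.coeff_coe, taylor_coeff] at h
    have h2 : ∑ j, (A k - A j) * (a k - a j)⁻¹ ^ 4 =
        A k * ∑ j ∈ Finset.univ.erase k, (a k - a j)⁻¹ ^ 4 -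
          ∑ j ∈ Finset.univ.erase k, A j * (a k - a j)⁻¹ ^ 4 := by
      rw [← Finset.sum_erase Finset.univ (a := k) (by simp), Finset.mul_sum,
        ← Finset.sum_sub_distrib]
      exact Finset.sum_congr rfl fun j _ => by ring
    rw [h2]
    simp only [if_true, OfNat.ofNat_ne_zero, if_false] at h
    linear_combination (1 / 2 : ℂ) * h
  -- The matrix with off-diagonal entries -(a_k - a_j)⁻⁴ and zero row sums is symmetric, so it can
  -- be moved from A to ξ, which it kills.
  have hswap : ∑ k, ∑ j, ξ k * ((A k - A j) * (a k - a j)⁻¹ ^ 4) =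
      ∑ k, ∑ j, A k * ((ξ k - ξ j) * (a k - a j)⁻¹ ^ 4) := by
    have e1 : ∀ k j, ξ k * ((A k - A j) * (a k - a j)⁻¹ ^ 4) =
        ξ k * A k * (a k - a j)⁻¹ ^ 4 - ξ k * A j * (a k - a j)⁻¹ ^ 4 := fun k j => by ring
    have e2 : ∀ k j, A k * ((ξ k - ξ j) * (a k - a j)⁻¹ ^ 4) =
        ξ k * A k * (a k - a j)⁻¹ ^ 4 - ξ j * A k * (a k - a j)⁻¹ ^ 4 := fun k j => by ring
    simp only [e1, e2, Finset.sum_sub_distrib]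
    congr 1
    rw [Finset.sum_comm]
    refine Finset.sum_congr rfl fun k _ => Finset.sum_congr rfl fun j _ => ?_
    rw [← neg_sub (a k), inv_neg]
    ring
  simp only [← Finset.mul_sum, hξ, mul_zero, Finset.sum_const_zero] at hswap
  simp only [hval, mul_left_comm _ (3 : ℂ), ← Finset.mul_sum, hswap, mul_zero]

/-- Orthogonality to Q'' involves the moments of order at most deg Q''. Once Q'' has exact degree r,
the lower moments drop out and the one of order r must vanish. -/
theorem odd_moment_eq_zero (ha : Function.Injective a) (hl : l ≠ 0)
    (hN : N = triangle (m + 2)) (hP : symmTau (m + 1) = C l * ∏ j, (X - C (a j))) {ξ : Fin N → ℂ}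
    (hξ : ∀ k, ∑ j, (ξ k - ξ j) * (a k - a j)⁻¹ ^ 4 = 0) (r : ℕ) (hr : Odd r)
    (hlow : ∀ s < r, ∑ k, ξ k * a k ^ s = 0) : ∑ k, ξ k * a k ^ r = 0 := by
  obtain ⟨i, rfl⟩ := hr
  -- This index makes the numerator of degree 2N + r + 2, so the quotient by τ² has degree r + 2.
  -- Its leading coefficient is nonzero by `sqCoeff_ne_zero`; the double-pole terms have degree too
  -- small to interfere.
  obtain ⟨Q, A, hQ, hsum⟩ := sum_mul_hasseDeriv_eq_zero ha hl hP hξ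
    (2 * (m + 1) + 1 + 2 * (i + 1))
  have htri : triangle (m + 2) = triangle (m + 1) + (m + 1) := triangle_succ (m + 1)
  set d := 2 * i + 1 with hd
  have hrest : (∑ j, C (A j) * deletedProd a l j ^ 2).natDegree ≤ 2 * (N - 1) := by
    refine natDegree_sum_le_of_forall_le _ _ fun j _ => natDegree_mul_le.trans ?_
    rw [natDegree_C, zero_add]
    exact natDegree_pow_le.trans (Nat.mul_le_mul_left 2 (natDegree_deletedProd_le j))
  have hdeg : (2 * triangle (m + 1) + (2 * (m + 1) + 1 + 2 * (i + 1))) = 2 * N + (d + 2) := by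
    rw [hN, htri]; omega
  have hPQ : symmTau (m + 1) ^ 2 * Q = symmTauSq (m + 1) (2 * (m + 1) + 1 + 2 * (i + 1)) -
      ∑ j, C (A j) * deletedProd a l j ^ 2 := by rw [hQ]; ring
  have hPne := symmTau_ne_zero (m + 1)
  have hPdeg : (symmTau (m + 1)).natDegree = N := by
    refine le_antisymm ?_ (le_natDegree_of_ne_zero ?_)
    · rw [hN]; exact natDegree_symmTau_le (m + 1)
    · rw [hN]; exact coeff_symmTau_ne_zero (m + 1)
  have hQdeg : Q.natDegree ≤ d + 2 := by
    by_cases hQ0 : Q = 0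
    · simp [hQ0]
    have h1 : (symmTau (m + 1) ^ 2 * Q).natDegree ≤ 2 * N + (d + 2) := by
      rw [hPQ]
      refine (natDegree_sub_le _ _).trans (max_le ?_ (hrest.trans (by omega)))
      rw [← hdeg]
      exact natDegree_symmTauSq_le _ _
    rw [natDegree_mul (pow_ne_zero 2 hPne) hQ0, natDegree_pow, hPdeg] at h1
    omega
  have hQc : Q.coeff (d + 2) ≠ 0 := by
    intro h0
    have h1 := congrArg (fun f => f.coeff (2 * N + (d + 2))) hPQ
    rw [coeff_mul_add_eq_of_natDegree_le (natDegree_pow_le_of_le 2 hPdeg.le) hQdeg, h0, mul_zero,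
      coeff_sub, ← hdeg, coeff_symmTauSq, hdeg,
      coeff_eq_zero_of_natDegree_lt (hrest.trans_lt (by omega)), sub_zero] at h1
    exact sqCoeff_ne_zero m (i + 1) h1.symm
  have hH : (hasseDeriv 2 Q).natDegree < d + 1 := by
    have := natDegree_hasseDeriv_le Q 2
    omega
  simp only [eval_eq_sum_range' hH, Finset.mul_sum] at hsum
  rw [Finset.sum_comm, Finset.sum_range_succ, Finset.sum_eq_zero, zero_add] at hsum
  · rw [← Finset.sum_congr rfl fun k _ => mul_left_comm ((hasseDeriv 2 Q).coeff d) (ξ k) (a k ^ d),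
      ← Finset.mul_sum, hasseDeriv_coeff] at hsum
    refine (mul_eq_zero.1 hsum).resolve_left (mul_ne_zero ?_ hQc)
    exact Nat.cast_ne_zero.2 (Nat.choose_pos (by omega)).ne'
  · intro s hs
    rw [← Finset.sum_congr rfl fun k _ => mul_left_comm ((hasseDeriv 2 Q).coeff s) (ξ k) (a k ^ s),
      ← Finset.mul_sum, hlow s (Finset.mem_range.1 hs), mul_zero]

end Moments

/-! ### Forces from the bilinear equation -/

section Forces

variable {N : ℕ} {a b : Fin N → ℂ}

theorem eval_derivative_C_mul_prod {ι : Type*} (s : Finset ι) (c : ι → ℂ) (l z : ℂ)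
    (h : ∀ j ∈ s, z ≠ c j) : (derivative (C l * ∏ j ∈ s, (X - C (c j)))).eval z =
      (C l * ∏ j ∈ s, (X - C (c j))).eval z * ∑ j ∈ s, (z - c j)⁻¹ := by
  classical
  induction s using Finset.induction_on with
  | empty => simp
  | insert i s hi ih =>
    have h1 : z - c i ≠ 0 := sub_ne_zero.2 (h i (Finset.mem_insert_self i s))
    have e : C l * ∏ j ∈ insert i s, (X - C (c j)) =
        (X - C (c i)) * (C l * ∏ j ∈ s, (X - C (c j))) := by
      rw [Finset.prod_insert hi]; ring
    have ih' := ih fun j hj => h j (Finset.mem_insert_of_mem hj)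
    rw [e, Finset.sum_insert hi]
    generalize C l * ∏ j ∈ s, (X - C (c j)) = S at ih' ⊢
    rw [derivative_mul, eval_add, eval_mul, eval_mul, eval_mul, ih']
    simp only [derivative_sub, derivative_X, derivative_C, sub_zero, eval_one, eval_sub, eval_X,
      eval_C]
    field_simp

theorem eval_derivative_at_root (l : ℂ) (k : Fin N) :
    (derivative (C l * ∏ j, (X - C (a j)))).eval (a k) = (deletedProd a l k).eval (a k) := by
  rw [← X_sub_C_mul_deletedProd a l k, derivative_mul]
  simp

/-- Write P = (X - a_k)R. At a_k one has P = 0, P' = R and P'' = 2R', so the bilinear equation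
reduces to R'/R - Q'/Q = μ there. -/
theorem force_eq_of_bilinear (ha : Function.Injective a) (hab : ∀ i j, a i ≠ b j) {l l' μ : ℂ}
    (hl : l ≠ 0) (hl' : l' ≠ 0) {P Q : ℂ[X]} (hP : P = C l * ∏ j, (X - C (a j)))
    (hQ : Q = C l' * ∏ j, (X - C (b j)))
    (h : derivative (derivative P) * Q - 2 * derivative P * derivative Q +
      P * derivative (derivative Q) + 2 * C μ * (P * derivative Q - derivative P * Q) = 0)
    (k : Fin N) : ∑ j, (a k - a j)⁻¹ - ∑ j, (a k - b j)⁻¹ = μ := by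
  set R := deletedProd a l k with hR
  have hPR : P = (X - C (a k)) * R := by rw [hP, X_sub_C_mul_deletedProd]
  have hRk : R.eval (a k) ≠ 0 := eval_deletedProd_ne_zero ha hl k
  have hQk : Q.eval (a k) ≠ 0 := by
    rw [hQ, eval_mul, eval_C, eval_prod]
    refine mul_ne_zero hl' (Finset.prod_ne_zero_iff.2 fun j _ => ?_)
    rw [eval_sub, eval_X, eval_C]
    exact sub_ne_zero.2 (hab k j)
  have hR' : (derivative R).eval (a k) = R.eval (a k) * ∑ j, (a k - a j)⁻¹ := by
    rw [hR, deletedProd, eval_derivative_C_mul_prod _ _ _ _ fun j hj e =>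
      (Finset.ne_of_mem_erase hj) (ha e).symm, Finset.sum_erase _ (by simp)]
  have hQ' : (derivative Q).eval (a k) = Q.eval (a k) * ∑ j, (a k - b j)⁻¹ := by
    rw [hQ, eval_derivative_C_mul_prod _ _ _ _ fun j _ => hab k j]
  have h1 := congrArg (eval (a k)) h
  simp only [hPR, derivative_mul, derivative_add, derivative_sub, derivative_X, derivative_C,
    eval_add, eval_sub, eval_mul, eval_X, eval_C, sub_self, zero_mul, eval_zero, hR',
    hQ', sub_zero, one_mul, eval_ofNat, add_zero] at h1
  have h2 : (2 * (R.eval (a k) * Q.eval (a k))) *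
      (∑ j, (a k - a j)⁻¹ - ∑ j, (a k - b j)⁻¹ - μ) = 0 := by linear_combination h1
  exact sub_eq_zero.1 ((mul_eq_zero.1 h2).resolve_left
    (mul_ne_zero two_ne_zero (mul_ne_zero hRk hQk)))

end Forces

/-! ### Conjugation symmetry, simple roots and the conclusion -/

/-- Complex conjugation permutes the entries of all vectors with a given conjugation pattern in
the same way. -/
theorem exists_perm_conj {N : ℕ} (i₀ : ℕ) (hi₀ : 2 * i₀ ≤ N) : ∃ σ : Equiv.Perm (Fin N),
    ∀ v : Fin N → ℂ, IsConjPaired i₀ v → ∀ j, starRingEnd ℂ (v j) = v (σ j) := by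
  have hlt : ∀ j : Fin N, (if (j : ℕ) < 2 * i₀ then
      (if Even (j : ℕ) then (j : ℕ) + 1 else (j : ℕ) - 1) else (j : ℕ)) < N := by
    intro j
    have := j.2
    split_ifs with h1 h2
    · obtain ⟨r, hr⟩ := h2
      omega
    · omega
    · omega
  set f : Fin N → Fin N := fun j => ⟨_, hlt j⟩ with hf
  have hinv : Function.Involutive f := by
    intro j
    ext
    simp only [hf]
    have := j.2
    rcases Nat.even_or_odd' (j : ℕ) with ⟨r, hr | hr⟩
    · by_cases h1 : (j : ℕ) < 2 * i₀
      · have h2 : Even (j : ℕ) := ⟨r, by omega⟩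
        have h3 : ¬ Even ((j : ℕ) + 1) := by
          rw [Nat.not_even_iff_odd]; exact h2.add_one
        simp only [h1, h2, h3, if_true, if_false]
        rw [if_pos (by omega)]
        omega
      · simp [h1]
    · by_cases h1 : (j : ℕ) < 2 * i₀
      · have h2 : ¬ Even (j : ℕ) := Nat.not_even_iff_odd.2 ⟨r, hr⟩
        have h3 : Even ((j : ℕ) - 1) := ⟨r, by omega⟩
        simp only [h1, h2, h3, if_true, if_false]
        rw [if_pos (by omega)]
        omega
      · simp [h1]
  refine ⟨hinv.toPerm, fun v hv j => ?_⟩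
  change starRingEnd ℂ (v j) = v (f j)
  have hval : (f j : ℕ) = if (j : ℕ) < 2 * i₀ then
      (if Even (j : ℕ) then (j : ℕ) + 1 else (j : ℕ) - 1) else (j : ℕ) := rfl
  by_cases h1 : (j : ℕ) < 2 * i₀
  · rw [if_pos h1] at hval
    rcases Nat.even_or_odd' (j : ℕ) with ⟨r, hr | hr⟩
    · rw [if_pos ⟨r, by omega⟩] at hval
      rw [hv.1 r (by omega) j (f j) hr (by omega), Complex.conj_conj]
    · rw [if_neg (Nat.not_even_iff_odd.2 ⟨r, hr⟩)] at hval
      rw [hv.1 r (by omega) (f j) j (by omega) hr]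
  · rw [if_neg h1] at hval
    have h2 : f j = j := Fin.ext hval
    rw [h2]
    exact Complex.conj_eq_iff_im.2 (hv.2 j (not_lt.1 h1))

/-- A root of `τ_n` that is not a root of `τ_{n-1}` is simple. -/
theorem rootMultiplicity_symmTau_le_one {m : ℕ} {z : ℂ} (hz : (symmTauExt (m + 1) 0).eval z ≠ 0) :
    (symmTau (m + 1)).rootMultiplicity z ≤ 1 := by
  by_contra! hd
  set τ := symmTau (m + 1) with hτ
  set B := symmTauExt (m + 1) 0
  have hτ0 : τ ≠ 0 := symmTau_ne_zero _
  have hr1 : τ.IsRoot z := (rootMultiplicity_pos hτ0).1 (by omega)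
  have hm1 := derivative_rootMultiplicity_of_root hr1
  have hτ1 : derivative τ ≠ 0 := fun h => by
    rw [h, rootMultiplicity_zero] at hm1
    omega
  have hr2 : (derivative τ).IsRoot z := (rootMultiplicity_pos hτ1).1 (by omega)
  have hm2 := derivative_rootMultiplicity_of_root hr2
  have hτ2 : derivative (derivative τ) ≠ 0 := fun h => by
    have h1 := derivative_eq_zero.1 h
    rw [eq_C_of_natDegree_eq_zero h1, IsRoot.def, eval_C] at hr2
    exact hτ1 (by rw [eq_C_of_natDegree_eq_zero h1, hr2, C_0])
  -- For a root of multiplicity d ≥ 2, both τ and τ' are divisible by (X - z)^{d-1}, hence so is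
  -- τ''B. As B(z) ≠ 0, the power divides τ'', whose multiplicity at z is only d - 2.
  have hdvd : (X - C z) ^ (τ.rootMultiplicity z - 1) ∣ derivative (derivative τ) * B := by
    have h0 : (X - C z) ^ (τ.rootMultiplicity z - 1) ∣ τ :=
      (pow_dvd_pow _ (Nat.sub_le _ _)).trans (pow_rootMultiplicity_dvd τ z)
    have h1 : (X - C z) ^ (τ.rootMultiplicity z - 1) ∣ derivative τ := by
      rw [← hm1]; exact pow_rootMultiplicity_dvd _ z
    have h2 : derivative (derivative τ) * B =
        derivative τ * (2 * derivative B) - τ * derivative (derivative B) := by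
      linear_combination symmTauExt_hirota_zero m 0 two_pos
    rw [h2]
    exact dvd_sub (h1.mul_right _) (h0.mul_right _)
  have hcop : IsCoprime ((X - C z) ^ (τ.rootMultiplicity z - 1)) B := by
    refine IsCoprime.pow_left ?_
    exact ((irreducible_X_sub_C z).coprime_iff_not_dvd).2 fun h => hz (dvd_iff_isRoot.1 h)
  have := (le_rootMultiplicity_iff hτ2).2 (hcop.dvd_of_dvd_mul_right hdvd)
  omega

theorem proposition2 (n : ℕ) (hn : 1 ≤ n)
    -- `A_n` and `A_{n-1}` have no common root, or `A_n` has no repeated root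
    (hA : (∀ z : ℂ, ¬ ((symmAdlerMoser n).IsRoot z ∧ (symmAdlerMoser (n - 1)).IsRoot z)) ∨
      (symmAdlerMoser n).roots.Nodup)
    -- `a` lists the roots of `A_n`, numbered so that the first `2 i₀` form conjugate pairs
    -- and the remaining ones are real
    (a : Fin (n * (n + 1) / 2) → ℂ)
    (ha : Finset.univ.val.map a = (symmAdlerMoser n).roots)
    (i₀ : ℕ) (hi₀ : 2 * i₀ ≤ n * (n + 1) / 2) (hpair : IsConjPaired i₀ a) :
    -- the vortices are pairwise distinct, so that the force map is differentiable at `(a, b)`,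
    -- `b = a*`, and a symmetric vector in the kernel of its derivative vanishes
    Function.Injective a ∧ (∀ i j, a i ≠ reflectVec a j) ∧
    DifferentiableAt ℂ (vortexForce (n * (n + 1) / 2)) (a, reflectVec a) ∧
    ∀ ξ η : Fin (n * (n + 1) / 2) → ℂ, IsSymmetricVec i₀ ξ η →
      fderiv ℂ (vortexForce (n * (n + 1) / 2)) (a, reflectVec a) (ξ, η) = 0 →
      ξ = 0 ∧ η = 0 := by
  obtain ⟨m, rfl⟩ := Nat.exists_eq_add_of_le' hn
  have hN : (m + 1) * (m + 1 + 1) / 2 = triangle (m + 2) := (triangle_succ_eq (m + 1)).symm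
  generalize (m + 1) * (m + 1 + 1) / 2 = N at *
  obtain ⟨s, hs, hsA⟩ := exists_symmAdlerMoser_eq (m + 1)
  change symmAdlerMoser (m + 1) = C s * symmTau (m + 1) at hsA
  have hroots : Finset.univ.val.map a = (symmTau (m + 1)).roots := by
    rw [ha, hsA, roots_C_mul _ hs]
  set τ := symmTau (m + 1) with hτ
  have hτ0 : τ ≠ 0 := symmTau_ne_zero _
  set l := τ.leadingCoeff with hl
  have hl0 : l ≠ 0 := leadingCoeff_ne_zero.2 hτ0
  have hP : τ = C l * ∏ j, (X - C (a j)) := by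
    conv_lhs => rw [(IsAlgClosed.splits τ).eq_prod_roots]
    rw [← hroots, Multiset.map_map]
    rfl
  have hnodup : τ.roots.Nodup := by
    rcases hA with hA | hA
    · rw [Multiset.nodup_iff_count_le_one]
      intro z
      rw [count_roots]
      by_cases hz : τ.IsRoot z
      · refine rootMultiplicity_symmTau_le_one fun h0 => hA z ⟨?_, ?_⟩
        · rw [hsA, IsRoot.def, eval_mul, hz.eq_zero, mul_zero]
        · obtain ⟨s', hs', hs'A⟩ := exists_symmAdlerMoser_eq m
          obtain ⟨s'', hs'', hE⟩ := exists_symmTauExt_zero_eq m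
          rw [hE, eval_mul, eval_C] at h0
          rw [Nat.add_sub_cancel, hs'A, IsRoot.def, eval_mul]
          exact mul_eq_zero_of_right _ ((mul_eq_zero.1 h0).resolve_left hs'')
      · rw [rootMultiplicity_eq_zero hz]
        exact zero_le_one
    · rwa [hsA, roots_C_mul _ hs] at hA
  have hinj : Function.Injective a := by
    rw [← hroots] at hnodup
    exact fun i j hij => Multiset.inj_on_of_nodup_map hnodup i (Finset.mem_univ_val i) j
      (Finset.mem_univ_val j) hij
  -- The permutation turns the antilinear symmetry into complex-linear relations shared by a and ξ:
  -- b_j = -a_{σ j} and η_j = -ξ_{σ j}.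
  obtain ⟨σ, hσ⟩ := exists_perm_conj i₀ hi₀
  have hb : ∀ j, reflectVec a j = -a (σ j) := fun j => by rw [reflectVec, hσ a hpair]
  have hbinj : Function.Injective (reflectVec a) := fun i j hij => by
    rw [hb, hb] at hij
    exact σ.injective (hinj (neg_injective hij))
  have hbil := symmTau_bilinear m
  rw [← hτ] at hbil
  have hroot : ∀ k, τ.eval (a k) = 0 := fun k => by
    rw [hP, eval_mul, eval_prod, Finset.prod_eq_zero (Finset.mem_univ k) (by simp), mul_zero]
  have hder : ∀ k, (derivative τ).eval (a k) ≠ 0 := fun k => by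
    rw [hP, eval_derivative_at_root]
    exact eval_deletedProd_ne_zero hinj hl0 k
  -- At a common root of τ(z) and τ(-z) every term of the bilinear equation vanishes except the
  -- product of first derivatives, which is nonzero because the roots are simple.
  have hab : ∀ i j, a i ≠ reflectVec a j := by
    intro i j hij
    rw [hb] at hij
    have h1 := congrArg (eval (a i)) hbil
    have h2 : -a i = a (σ j) := by rw [hij, neg_neg]
    simp only [eval_add, eval_sub, eval_mul, eval_comp, derivative_comp, eval_neg, eval_X, h2,
      hroot, mul_zero, zero_mul, derivative_neg, derivative_X, eval_one, zero_sub, add_zero,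
      sub_self, eval_zero, eval_ofNat] at h1
    have h3 : 2 * ((derivative τ).eval (a i) * (derivative τ).eval (a (σ j))) = 0 := by
      linear_combination h1
    exact mul_ne_zero two_ne_zero (mul_ne_zero (hder i) (hder (σ j))) h3
  refine ⟨hinj, hab, differentiableAt_vortexForce hinj hbinj hab, ?_⟩
  intro ξ η ⟨hη, hξpair⟩ hker
  have hησ : ∀ j, η j = -ξ (σ j) := fun j => by rw [hη, reflectVec, hσ ξ hξpair]
  suffices hξ0 : ξ = 0 from ⟨hξ0, by rw [hη, hξ0]; ext j; simp [reflectVec]⟩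
  have hQ : τ.comp (-X) = C (l * (-1) ^ N) * ∏ j, (X - C (reflectVec a j)) := by
    have h1 : ∏ j, (X - C (reflectVec a j)) = ∏ j, (X + C (a j)) := by
      rw [← Equiv.prod_comp σ fun j => (X + C (a j))]
      exact Finset.prod_congr rfl fun j _ => by rw [hb, C_neg, sub_neg_eq_add]
    have h2 : ((-1 : ℂ[X]) ^ N) = ∏ _j : Fin N, (-1 : ℂ[X]) := by simp
    rw [h1, hP, mul_comp, C_comp, prod_comp, C_mul, C_pow, C_neg, C_1, mul_assoc, h2,
      ← Finset.prod_mul_distrib]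
    congr 1
    refine Finset.prod_congr rfl fun j _ => ?_
    rw [sub_comp, X_comp, C_comp]
    ring
  have hl'0 : l * (-1) ^ N ≠ 0 := mul_ne_zero hl0 (by simp)
  set ε : Fin N ⊕ Fin N → ℂ := Sum.elim (fun _ => 1) (fun _ => -1) with hε
  set x : Fin N ⊕ Fin N → ℂ := Sum.elim a (reflectVec a) with hx
  set ζ : Fin N ⊕ Fin N → ℂ := Sum.elim ξ η with hζ
  have hxinj : Function.Injective x := hinj.sumElim hbinj hab
  have hεε : ∀ i, ε i * ε i = 1 := by rintro (i | i) <;> simp [hε]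
  have hF : ∀ i, ∑ j, ε j * (x i - x j)⁻¹ = 1 := by
    rintro (k | k)
    · rw [← force_eq_of_bilinear (μ := 1) hinj hab hl0 hl'0 hP hQ
        (by rw [C_1]; linear_combination hbil) k, Fintype.sum_sum_type]
      simp only [hε, hx, Sum.elim_inl, Sum.elim_inr, one_mul, neg_mul, Finset.sum_neg_distrib]
      ring
    -- Exchanging τ(z) and τ(-z) changes the sign of the first-order term, hence of μ; the signs ε
    -- restore the common value 1.
    · have h := force_eq_of_bilinear (μ := -1) hbinj (fun i j => (hab j i).symm) hl'0 hl0 hQ hP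
        (by rw [C_neg, C_1]; linear_combination hbil) k
      rw [Fintype.sum_sum_type]
      simp only [hε, hx, Sum.elim_inl, Sum.elim_inr, one_mul, neg_mul, Finset.sum_neg_distrib]
      linear_combination -h
  have hL : ∀ i, ∑ j, ε j * (ζ i - ζ j) * (x i - x j)⁻¹ ^ 2 = 0 :=
    linearized_forces_eq_zero hinj hbinj hab hker
  have hlocus : ∀ k, ∑ j, (ξ k - ξ j) * (a k - a j)⁻¹ ^ 4 = 0 := by
    intro k
    have h := linearized_locus hxinj hεε hF hL (Sum.inl k) rfl
    rw [Fintype.sum_sum_type] at h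
    simp only [hε, hx, hζ, Sum.elim_inl, Sum.elim_inr, add_neg_cancel, zero_mul,
      Finset.sum_const_zero, add_zero, mul_assoc, ← Finset.mul_sum] at h
    exact (mul_eq_zero.1 h).resolve_left (by norm_num)
  have hdual : ∀ r, ∑ k, η k * reflectVec a k ^ r = -((-1) ^ r * ∑ k, ξ k * a k ^ r) := by
    intro r
    rw [← Equiv.sum_comp σ fun k => ξ k * a k ^ r, Finset.mul_sum, ← Finset.sum_neg_distrib]
    refine Finset.sum_congr rfl fun k _ => ?_
    rw [hησ, hb, neg_pow]
    ring
  have hmom : ∀ r, ∑ k, ξ k * a k ^ r = 0 := by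
    intro r
    induction r using Nat.strong_induction_on with
    | _ r ih =>
      rcases Nat.even_or_odd r with hr | hr
      -- For even r the contributions of a and b to the signed moment agree and give twice the
      -- desired sum; for odd r they would cancel.
      · have h := moment_eq_zero_of_lower hxinj hεε one_ne_zero hF hL r
          (fun s hs => by
            rw [Fintype.sum_sum_type]
            simp only [hx, hζ, Sum.elim_inl, Sum.elim_inr, hdual, ih s hs]
            simp)
          (fun s hs => by
            rw [Fintype.sum_sum_type]
            simp only [hx, hζ, hε, Sum.elim_inl, Sum.elim_inr, one_mul, neg_mul,
              Finset.sum_neg_distrib, hdual, ih s hs]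
            simp)
        rw [Fintype.sum_sum_type] at h
        simp only [hx, hζ, hε, Sum.elim_inl, Sum.elim_inr, one_mul, neg_mul,
          Finset.sum_neg_distrib, hdual, hr.neg_one_pow] at h
        linear_combination (1 / 2 : ℂ) * h
      · exact odd_moment_eq_zero hinj hl0 hN hP hlocus r hr ih
  exact Matrix.eq_zero_of_forall_pow_sum_mul_pow_eq_zero hinj fun i => hmom i
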